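/- Let $D\subseteq\mathbb R^2$ be an open set with coordinates $(u,v)$, and let $g$ be a $C^\infty$ Riemannian metric on $D$. Suppose that the net of coordinate lines has the Ivory property for small net quadrilaterals: every point of $D$ has a neighbourhood $W\subseteq D$ such that, for every coordinate rectangle $[u_1,u_2]\times[v_1,v_2]\subseteq W$ with $u_1<u_2$ and $v_1<v_2$, the geodesic diagonals of this rectangle have equal lengths, that is, every geodesic segment of $g$ in $W$ from $(u_1,v_1)$ to $(u_2,v_2)$ has the same length as every geodesic segment of $g$ in $W$ from $(u_1,v_2)$ to $(u_2,v_1)$. Then: 1. the coordinate lines are orthogonal: $g(\partial_u,\partial_v)=0$ on $D$; 2. $g$ is Liouville in the coordinates $(u,v)$: for all open intervals $I,J\subseteq\mathbb R$ (bounded or not) with $I\times J\subseteq D$ there are $C^\infty$ functions $U_1,U_2$ on $I$ and $V_1,V_2$ on $J$ such that on $I\times J$ $$g=(U_1(u)-V_1(v))\,\bigl(U_2(u)\,du^2+V_2(v)\,dv^2\bigr).$$ -/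

import Mathlib

open Set Topology
open scoped ContDiff Matrix

noncomputable section

namespace IvoryLiouville

/-- The coordinate plane. A point `x` has coordinates `u = x 0` and `v = x 1`. -/
abbrev Plane : Type := Fin 2 → ℝ

/-- `g` is a smooth Riemannian metric on `D`, given in the coordinates `(u, v)` by its matrix
`g x i j = ⟨∂ᵢ, ∂ⱼ⟩` at the point `x`. Values of `g` off `D` are irrelevant. -/
structure IsRiemannianMetricOn (g : Plane → Matrix (Fin 2) (Fin 2) ℝ) (D : Set Plane) : Prop where
  smooth : ∀ i j, ContDiffOn ℝ ∞ (fun x => g x i j) D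
  posDef : ∀ x ∈ D, (g x).PosDef

/-- The partial derivative `∂ᵢ f` at `x`. -/
def partialDeriv (i : Fin 2) (f : Plane → ℝ) (x : Plane) : ℝ :=
  fderiv ℝ f x (Pi.single i 1)

/-- The Christoffel symbol `Γᵏᵢⱼ` of the Levi-Civita connection of `g` at `x`. -/
def christoffel (g : Plane → Matrix (Fin 2) (Fin 2) ℝ) (x : Plane) (k i j : Fin 2) : ℝ :=
  (1 / 2 : ℝ) * ∑ l, (g x)⁻¹ k l *
    (partialDeriv i (fun y => g y j l) x + partialDeriv j (fun y => g y i l) x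
      - partialDeriv l (fun y => g y i j) x)

/-- The velocity of a curve parametrized by `[0, 1]` (one-sided at the end points). -/
def velocity (γ : ℝ → Plane) (t : ℝ) : Plane := derivWithin γ (Icc 0 1) t

/-- The acceleration, in coordinates, of a curve parametrized by `[0, 1]`. -/
def acceleration (γ : ℝ → Plane) (t : ℝ) : Plane := derivWithin (velocity γ) (Icc 0 1) t

/-- `γ : [0, 1] → W` is a (smooth, affinely parametrized) geodesic segment of `g` from `p` to `q`,
contained in `W`. -/
structure IsGeodesicSegment (g : Plane → Matrix (Fin 2) (Fin 2) ℝ) (W : Set Plane)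
    (p q : Plane) (γ : ℝ → Plane) : Prop where
  smooth : ContDiffOn ℝ ∞ γ (Icc 0 1)
  mapsTo : MapsTo γ (Icc 0 1) W
  source : γ 0 = p
  target : γ 1 = q
  geodesic : ∀ t ∈ Icc (0 : ℝ) 1, ∀ k,
    acceleration γ t k
      + ∑ i, ∑ j, christoffel g (γ t) k i j * velocity γ t i * velocity γ t j = 0

/-- The length with respect to `g` of a curve parametrized by `[0, 1]`. -/
def length (g : Plane → Matrix (Fin 2) (Fin 2) ℝ) (γ : ℝ → Plane) : ℝ :=
  ∫ t in (0 : ℝ)..1, √(velocity γ t ⬝ᵥ (g (γ t) *ᵥ velocity γ t))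

/-- The Ivory property of the net of coordinate lines, for small net quadrilaterals: every point
of `D` has a neighbourhood `W ⊆ D` such that in every coordinate rectangle
`[u₁, u₂] × [v₁, v₂] ⊆ W` the two geodesic diagonals in `W` have equal lengths. -/
def HasIvoryProperty (g : Plane → Matrix (Fin 2) (Fin 2) ℝ) (D : Set Plane) : Prop :=
  ∀ p ∈ D, ∃ W ∈ 𝓝 p, W ⊆ D ∧
    ∀ u₁ u₂ v₁ v₂ : ℝ, u₁ < u₂ → v₁ < v₂ →
      (∀ u ∈ Icc u₁ u₂, ∀ v ∈ Icc v₁ v₂, ![u, v] ∈ W) →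
      ∀ γ₁ γ₂ : ℝ → Plane,
        IsGeodesicSegment g W ![u₁, v₁] ![u₂, v₂] γ₁ →
        IsGeodesicSegment g W ![u₁, v₂] ![u₂, v₁] γ₂ →
        length g γ₁ = length g γ₂

/-- On the coordinate rectangle `I × J` the metric has the Liouville form
`(U₁(u) - V₁(v)) (U₂(u) du² + V₂(v) dv²)`, with smooth functions `U₁, U₂` of `u` and
`V₁, V₂` of `v`. -/
def HasLiouvilleForm (g : Plane → Matrix (Fin 2) (Fin 2) ℝ) (I J : Set ℝ) : Prop :=
  ∃ U₁ U₂ V₁ V₂ : ℝ → ℝ,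
    ContDiffOn ℝ ∞ U₁ I ∧ ContDiffOn ℝ ∞ U₂ I ∧ ContDiffOn ℝ ∞ V₁ J ∧ ContDiffOn ℝ ∞ V₂ J ∧
    ∀ u ∈ I, ∀ v ∈ J, g ![u, v] = (U₁ u - V₁ v) • !![U₂ u, 0; 0, V₂ v]

end IvoryLiouville

end

/-! Parametrize the two geodesic diagonals of a small coordinate rectangle by [0, 1]. By the Ivory
property they have the same constant squared speed N. As the rectangle shrinks the diagonals become
straight, so (1, 1) and (1, -1) have equal length at every point: the coordinate lines are
orthogonal (`HasIvoryProperty.orthogonal`).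

The sides of the rectangle can be moved independently, and the first variation formula turns the
equality of the two squared lengths into equalities between momenta: at the two corners on a common
side, the momentum components normal to that side in coordinates agree up to sign
(`IsGeodesicFamily.momenta_eq`). Write E = `g x 0 0` and G = `g x 1 1`. With X, X' the squared
u-momenta on the sides u₁, u₂ and Y, Y' the squared v-momenta on the sides v₁, v₂, the energy at the
four corners gives four linear equations of the form X/E + Y/G = N
(`IsGeodesicFamily.exists_momenta`).

Eliminating X', Y, Y' and shrinking a rectangle with sides τs, τt gives a relation at order τ⁴
(`HasIvoryProperty.infinitesimal_relation`). Its dependence on t/s forces ∂ᵤ∂ᵥ log(G/E) = 0, hence E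
= l·U(u) and G = l·V(v). The corner equations become X/U + Y/V = N·l, and their alternating sum says
that the mixed difference of l vanishes; so l is a function of u minus a function of v
(`HasIvoryProperty.mixedPartial_conformal_eq_zero`).

Short geodesics come from a contraction argument, which makes them Lipschitz in their end points.
This suffices for the first variation: no differentiable dependence on the end points is used. -/

namespace IvoryLiouville

/-! ### Two-point boundary value problems by contraction. -/

section BoundaryValueProblem

variable {E : Type*} [NormedAddCommGroup E] [NormedSpace ℝ E]

/-- The velocity of the curve on `[0, 1]` from `p` to `q` with acceleration `z`. -/
noncomputable def bvpVelocity (p q : E) (z : ℝ → E) (t : ℝ) : E :=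
  (q - p) - (∫ s in (0 : ℝ)..1, ∫ r in (0 : ℝ)..s, z r) + ∫ s in (0 : ℝ)..t, z s

/-- The curve on `[0, 1]` from `p` to `q` with acceleration `z`. -/
noncomputable def bvpCurve (p q : E) (z : ℝ → E) (t : ℝ) : E :=
  p + ∫ s in (0 : ℝ)..t, bvpVelocity p q z s

theorem continuous_primitive {z : ℝ → E} (hz : Continuous z) :
    Continuous fun t => ∫ s in (0 : ℝ)..t, z s :=
  intervalIntegral.continuous_primitive (fun a b => hz.intervalIntegrable a b) 0

theorem continuous_bvpVelocity (p q : E) {z : ℝ → E} (hz : Continuous z) :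
    Continuous (bvpVelocity p q z) :=
  continuous_const.add (continuous_primitive hz)

theorem continuous_bvpCurve (p q : E) {z : ℝ → E} (hz : Continuous z) :
    Continuous (bvpCurve p q z) :=
  continuous_const.add (continuous_primitive (continuous_bvpVelocity p q hz))

theorem bvpCurve_zero (p q : E) (z : ℝ → E) : bvpCurve p q z 0 = p := by
  simp [bvpCurve]

theorem bvpVelocity_zero_fun (p q : E) (t : ℝ) : bvpVelocity p q 0 t = q - p := by
  simp [bvpVelocity]

theorem bvpCurve_self_zero_fun (p : E) (t : ℝ) : bvpCurve p p 0 t = p := by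
  simp [bvpCurve, bvpVelocity_zero_fun]

theorem bvpVelocity_sub (p q p' q' : E) {z z' : ℝ → E} (hz : Continuous z) (hz' : Continuous z')
    (t : ℝ) : bvpVelocity p q z t - bvpVelocity p' q' z' t
      = bvpVelocity (p - p') (q - q') (z - z') t := by
  have h : ∀ s, ∫ r in (0 : ℝ)..s, (z - z') r
      = (∫ r in (0 : ℝ)..s, z r) - ∫ r in (0 : ℝ)..s, z' r := fun s =>
    intervalIntegral.integral_sub (hz.intervalIntegrable _ _) (hz'.intervalIntegrable _ _)
  simp only [bvpVelocity, h]
  rw [intervalIntegral.integral_sub ((continuous_primitive hz).intervalIntegrable _ _)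
    ((continuous_primitive hz').intervalIntegrable _ _)]
  abel

theorem bvpCurve_sub (p q p' q' : E) {z z' : ℝ → E} (hz : Continuous z) (hz' : Continuous z')
    (t : ℝ) : bvpCurve p q z t - bvpCurve p' q' z' t
      = bvpCurve (p - p') (q - q') (z - z') t := by
  simp only [bvpCurve, ← bvpVelocity_sub p q p' q' hz hz']
  rw [intervalIntegral.integral_sub ((continuous_bvpVelocity p q hz).intervalIntegrable _ _)
    ((continuous_bvpVelocity p' q' hz').intervalIntegrable _ _)]
  abel

theorem norm_integral_le_of_unit {z : ℝ → E} {C t : ℝ} (ht : t ∈ Icc (0 : ℝ) 1)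
    (h : ∀ s ∈ Icc (0 : ℝ) 1, ‖z s‖ ≤ C) : ‖∫ s in (0 : ℝ)..t, z s‖ ≤ C := by
  have hC : 0 ≤ C := (norm_nonneg _).trans (h 0 (by simp))
  refine (intervalIntegral.norm_integral_le_of_norm_le_const (C := C) fun s hs => ?_).trans ?_
  · rw [uIoc_of_le ht.1] at hs
    exact h s ⟨hs.1.le, hs.2.trans ht.2⟩
  · rw [sub_zero, abs_of_nonneg ht.1]
    exact mul_le_of_le_one_right hC ht.2

theorem norm_bvpVelocity_sub_le (p q : E) {z : ℝ → E} {C t : ℝ} (ht : t ∈ Icc (0 : ℝ) 1)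
    (h : ∀ s ∈ Icc (0 : ℝ) 1, ‖z s‖ ≤ C) : ‖bvpVelocity p q z t - (q - p)‖ ≤ 2 * C := by
  have e : bvpVelocity p q z t - (q - p)
      = (∫ s in (0 : ℝ)..t, z s) - ∫ s in (0 : ℝ)..1, ∫ r in (0 : ℝ)..s, z r := by
    rw [bvpVelocity]; abel
  rw [e, two_mul]
  exact (norm_sub_le _ _).trans (add_le_add (norm_integral_le_of_unit ht h)
    (norm_integral_le_of_unit (by simp) fun s hs => norm_integral_le_of_unit hs h))

theorem norm_bvpVelocity_le (p q : E) {z : ℝ → E} {C t : ℝ} (ht : t ∈ Icc (0 : ℝ) 1)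
    (h : ∀ s ∈ Icc (0 : ℝ) 1, ‖z s‖ ≤ C) : ‖bvpVelocity p q z t‖ ≤ ‖p‖ + ‖q‖ + 2 * C := by
  have h1 := norm_bvpVelocity_sub_le p q ht h
  have h2 := norm_sub_norm_le (bvpVelocity p q z t) (q - p)
  have h3 := norm_sub_le q p
  linarith

theorem norm_bvpCurve_le (p q : E) {z : ℝ → E} {C t : ℝ} (ht : t ∈ Icc (0 : ℝ) 1)
    (h : ∀ s ∈ Icc (0 : ℝ) 1, ‖z s‖ ≤ C) : ‖bvpCurve p q z t‖ ≤ 2 * ‖p‖ + ‖q‖ + 2 * C := by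
  have h1 := norm_integral_le_of_unit ht fun s hs => norm_bvpVelocity_le p q hs h
  have h2 := norm_add_le p (∫ s in (0 : ℝ)..t, bvpVelocity p q z s)
  rw [bvpCurve]
  linarith

/-- The constant 1/8 absorbs the growth under two integrations: for equal end points, the map from z
to Φ of its curve and velocity contracts by 1/4. -/
theorem norm_bvp_sub_le {Φ : E × E → E} (hΦ : LipschitzWith (1 / 8) Φ)
    (p q p' q' : E) {z z' : ℝ → E} (hz : Continuous z) (hz' : Continuous z') {C t : ℝ}
    (ht : t ∈ Icc (0 : ℝ) 1) (h : ∀ s ∈ Icc (0 : ℝ) 1, ‖z s - z' s‖ ≤ C) :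
    ‖Φ (bvpCurve p q z t, bvpVelocity p q z t) - Φ (bvpCurve p' q' z' t, bvpVelocity p' q' z' t)‖
      ≤ (2 * ‖p - p'‖ + ‖q - q'‖ + 2 * C) / 8 := by
  have h1 := hΦ.dist_le_mul (bvpCurve p q z t, bvpVelocity p q z t)
    (bvpCurve p' q' z' t, bvpVelocity p' q' z' t)
  have h2 := norm_bvpCurve_le (p - p') (q - q') (z := z - z') ht h
  have h3 := norm_bvpVelocity_le (p - p') (q - q') (z := z - z') ht h
  rw [← bvpCurve_sub p q p' q' hz hz'] at h2
  rw [← bvpVelocity_sub p q p' q' hz hz'] at h3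
  rw [dist_eq_norm, Prod.dist_eq, dist_eq_norm, dist_eq_norm] at h1
  have h4 := norm_nonneg (p - p')
  have h5 := max_le h2 (h3.trans (by linarith))
  refine h1.trans ?_
  simp only [NNReal.coe_div, NNReal.coe_one, NNReal.coe_ofNat]
  linarith

/-- `z` is the acceleration of a solution of `γ'' = Φ (γ, γ')` on `[0, 1]` from `p` to `q`. -/
structure IsBVPSolution (Φ : E × E → E) (p q : E) (z : ℝ → E) : Prop where
  continuous : Continuous z
  eq : ∀ t ∈ Icc (0 : ℝ) 1, z t = Φ (bvpCurve p q z t, bvpVelocity p q z t)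

/-- With a, b the distances of the end points, the maximum m of the left side satisfies m ≤ (2a + b
+ 2m)/8, hence m ≤ (2a + b)/6. -/
theorem IsBVPSolution.norm_sub_le {Φ : E × E → E} (hΦ : LipschitzWith (1 / 8) Φ)
    {p q p' q' : E} {z z' : ℝ → E} (hz : IsBVPSolution Φ p q z) (hz' : IsBVPSolution Φ p' q' z')
    {t : ℝ} (ht : t ∈ Icc (0 : ℝ) 1) : ‖z t - z' t‖ ≤ ‖p - p'‖ + ‖q - q'‖ := by
  obtain ⟨t₀, ht₀, hmax⟩ := (isCompact_Icc (a := (0 : ℝ)) (b := 1)).exists_isMaxOn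
    ⟨0, by simp⟩ (hz.continuous.sub hz'.continuous).norm.continuousOn
  have h := norm_bvp_sub_le hΦ p q p' q' hz.continuous hz'.continuous ht₀ hmax
  rw [← hz.eq t₀ ht₀, ← hz'.eq t₀ ht₀] at h
  have h2 : ‖z t - z' t‖ ≤ ‖z t₀ - z' t₀‖ := hmax ht
  simp only [Pi.sub_apply] at h
  have := norm_nonneg (p - p')
  have := norm_nonneg (q - q')
  linarith

theorem isBVPSolution_zero {Φ : E × E → E} {p : E} (h : Φ (p, 0) = 0) :
    IsBVPSolution Φ p p 0 :=
  ⟨continuous_zero, fun t _ => by simp [bvpCurve_self_zero_fun, bvpVelocity_zero_fun, h]⟩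

variable [CompleteSpace E]

theorem hasDerivAt_bvpVelocity (p q : E) {z : ℝ → E} (hz : Continuous z) (t : ℝ) :
    HasDerivAt (bvpVelocity p q z) (z t) t :=
  ((hz.integral_hasStrictDerivAt 0 t).hasDerivAt).const_add _

theorem hasDerivAt_bvpCurve (p q : E) {z : ℝ → E} (hz : Continuous z) (t : ℝ) :
    HasDerivAt (bvpCurve p q z) (bvpVelocity p q z t) t :=
  (((continuous_bvpVelocity p q hz).integral_hasStrictDerivAt 0 t).hasDerivAt).const_add _

theorem bvpCurve_one (p q : E) {z : ℝ → E} (hz : Continuous z) : bvpCurve p q z 1 = q := by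
  simp only [bvpCurve, bvpVelocity]
  rw [intervalIntegral.integral_add (by simp)
    ((continuous_primitive hz).intervalIntegrable _ _), intervalIntegral.integral_const]
  simp

theorem exists_isBVPSolution {Φ : E × E → E} (hΦ : LipschitzWith (1 / 8) Φ) (p q : E) :
    ∃ z, IsBVPSolution Φ p q z := by
  -- Constant extension beyond [0, 1] makes the acceleration continuous on ℝ, so curve and velocity
  -- have two-sided derivatives even at the end points.
  let ext : C(Icc (0 : ℝ) 1, E) → ℝ → E := fun y => IccExtend zero_le_one y
  have hext : ∀ y, Continuous (ext y) := fun y => y.continuous.Icc_extend'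
  let T : C(Icc (0 : ℝ) 1, E) → C(Icc (0 : ℝ) 1, E) := fun y =>
    ⟨fun t => Φ (bvpCurve p q (ext y) t, bvpVelocity p q (ext y) t),
      hΦ.continuous.comp (((continuous_bvpCurve p q (hext y)).comp continuous_subtype_val).prodMk
        ((continuous_bvpVelocity p q (hext y)).comp continuous_subtype_val))⟩
  have hT : ContractingWith (1 / 4) T := by
    refine ⟨by rw [← NNReal.coe_lt_coe]; norm_num, LipschitzWith.of_dist_le_mul fun y y' => ?_⟩
    rw [ContinuousMap.dist_le (by positivity)]
    intro t
    have := norm_bvp_sub_le hΦ p q p q (hext y) (hext y') t.2 (C := dist y y') fun s hs => by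
      rw [← dist_eq_norm]
      exact ContinuousMap.dist_apply_le_dist _
    simp only [sub_self, norm_zero] at this
    rw [dist_eq_norm]
    refine this.trans (le_of_eq ?_)
    simp only [NNReal.coe_div, NNReal.coe_one, NNReal.coe_ofNat]
    ring
  refine ⟨ext (hT.fixedPoint T), hext _, fun t ht => ?_⟩
  have h := DFunLike.congr_fun hT.fixedPoint_isFixedPt ⟨t, ht⟩
  rw [show ext (hT.fixedPoint T) t = hT.fixedPoint T ⟨t, ht⟩ from IccExtend_of_mem _ _ ht, ← h]
  rfl

end BoundaryValueProblem

/-! ### Uniform first and second order estimates on compact convex sets. -/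

section CompactConvex

variable {E F : Type*} [NormedAddCommGroup E] [NormedSpace ℝ E] [NormedAddCommGroup F]
  [NormedSpace ℝ F]

theorem exists_lipschitzOnWith_of_contDiffOn {f : E → F} {U K : Set E} (hU : IsOpen U)
    (hf : ContDiffOn ℝ 1 f U) (hK : IsCompact K) (hKc : Convex ℝ K) (hKU : K ⊆ U) :
    ∃ M, LipschitzOnWith M f K := by
  obtain ⟨M, hM⟩ := hK.exists_bound_of_continuousOn
    ((hf.continuousOn_fderiv_of_isOpen hU le_rfl).mono hKU)
  refine ⟨M.toNNReal, hKc.lipschitzOnWith_of_nnnorm_fderiv_le (𝕜 := ℝ)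
    (fun x hx => (hf.differentiableOn one_ne_zero).differentiableAt (hU.mem_nhds (hKU hx)))
    fun x hx => ?_⟩
  rw [← NNReal.coe_le_coe, coe_nnnorm]
  exact (hM x hx).trans (Real.le_coe_toNNReal M)

/-- The derivative is Lipschitz on K, so along the segment from x to y it differs from its value at
x by at most M‖y - x‖; the mean value inequality then applies. -/
theorem exists_taylor_bound {f : E → F} {U K : Set E} (hU : IsOpen U)
    (hf : ContDiffOn ℝ 2 f U) (hK : IsCompact K) (hKc : Convex ℝ K) (hKU : K ⊆ U) :
    ∃ M : ℝ, 0 ≤ M ∧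
      ∀ x ∈ K, ∀ y ∈ K, ‖f y - f x - fderiv ℝ f x (y - x)‖ ≤ M * ‖y - x‖ ^ 2 := by
  obtain ⟨M, hM⟩ := exists_lipschitzOnWith_of_contDiffOn hU
    (hf.fderiv_of_isOpen (m := 1) hU (by norm_num)) hK hKc hKU
  refine ⟨M, M.2, fun x hx y hy => ?_⟩
  have hs : segment ℝ x y ⊆ K := hKc.segment_subset hx hy
  have h := (convex_segment x y).norm_image_sub_le_of_norm_hasFDerivWithin_le' (𝕜 := ℝ)
    (f := f) (f' := fderiv ℝ f) (φ := fderiv ℝ f x) (C := M * ‖y - x‖)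
    (fun z hz => (((hf.differentiableOn two_ne_zero).differentiableAt
      (hU.mem_nhds (hKU (hs hz)))).hasFDerivAt).hasFDerivWithinAt)
    (fun z hz => (hM.norm_sub_le (hs hz) hx).trans
      (mul_le_mul_of_nonneg_left (norm_sub_le_of_mem_segment hz) M.2))
    (left_mem_segment ℝ x y) (right_mem_segment ℝ x y)
  rwa [mul_assoc, ← sq] at h

end CompactConvex

/-! ### The geodesic spray, the energy and the Euler-Lagrange equation. -/

theorem isOpen_prod_univ {D : Set Plane} (hD : IsOpen D) :
    IsOpen (D ×ˢ (univ : Set Plane)) := hD.prod isOpen_univ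

theorem contDiffOn_partialDeriv {D : Set Plane} (hD : IsOpen D) {f : Plane → ℝ}
    (hf : ContDiffOn ℝ ∞ f D) (i : Fin 2) : ContDiffOn ℝ ∞ (partialDeriv i f) D :=
  (hf.fderiv_of_isOpen (m := ∞) hD (by norm_num)).clm_apply contDiffOn_const

theorem fderiv_apply_eq_partialDeriv (f : Plane → ℝ) (x v : Plane) :
    fderiv ℝ f x v = v 0 * partialDeriv 0 f x + v 1 * partialDeriv 1 f x := by
  have h : v = v 0 • Pi.single 0 1 + v 1 • Pi.single 1 1 := by
    ext i; fin_cases i <;> simp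
  conv_lhs => rw [h]
  simp [partialDeriv]

/-- The acceleration prescribed by the geodesic equation at `(x, v)`. -/
noncomputable def geodesicSpray (g : Plane → Matrix (Fin 2) (Fin 2) ℝ) (z : Plane × Plane) : Plane :=
  fun k => -∑ i, ∑ j, christoffel g z.1 k i j * z.2 i * z.2 j

/-- The inner product `⟨v, w⟩` at `x`. -/
noncomputable def metricInner (g : Plane → Matrix (Fin 2) (Fin 2) ℝ) (x v w : Plane) : ℝ :=
  v ⬝ᵥ (g x *ᵥ w)

/-- The squared length of the tangent vector `(x, v)`. -/
noncomputable def speedSq (g : Plane → Matrix (Fin 2) (Fin 2) ℝ) (z : Plane × Plane) : ℝ :=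
  metricInner g z.1 z.2 z.2

section Metric

variable {g : Plane → Matrix (Fin 2) (Fin 2) ℝ} {D : Set Plane}

theorem metricInner_eq (g : Plane → Matrix (Fin 2) (Fin 2) ℝ) (x v w : Plane) :
    metricInner g x v w = v 0 * (g x 0 0 * w 0 + g x 0 1 * w 1)
      + v 1 * (g x 1 0 * w 0 + g x 1 1 * w 1) := by
  simp [metricInner, dotProduct, Matrix.mulVec, Fin.sum_univ_two]

theorem IsRiemannianMetricOn.symm (hg : IsRiemannianMetricOn g D) {x : Plane} (hx : x ∈ D)
    (i j : Fin 2) : g x i j = g x j i := by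
  simpa using (hg.posDef x hx).isHermitian.apply j i

theorem IsRiemannianMetricOn.det_pos (hg : IsRiemannianMetricOn g D) {x : Plane} (hx : x ∈ D) :
    0 < (g x).det := (hg.posDef x hx).det_pos

theorem IsRiemannianMetricOn.diag_pos (hg : IsRiemannianMetricOn g D) {x : Plane} (hx : x ∈ D)
    (i : Fin 2) : 0 < g x i i := (hg.posDef x hx).diag_pos

theorem IsRiemannianMetricOn.speedSq_nonneg (hg : IsRiemannianMetricOn g D) {x : Plane}
    (hx : x ∈ D) (v : Plane) : 0 ≤ speedSq g (x, v) := by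
  have h := (hg.posDef x hx).posSemidef.dotProduct_mulVec_nonneg v
  rwa [star_trivial] at h

theorem IsRiemannianMetricOn.contDiffOn_inv (hg : IsRiemannianMetricOn g D) (i j : Fin 2) :
    ContDiffOn ℝ ∞ (fun x => (g x)⁻¹ i j) D := by
  have hdet : ContDiffOn ℝ ∞ (fun x => ((g x).det)⁻¹) D := by
    refine ContDiffOn.inv ?_ fun x hx => (hg.det_pos hx).ne'
    simp only [Matrix.det_fin_two]
    exact ((hg.smooth 0 0).mul (hg.smooth 1 1)).sub ((hg.smooth 0 1).mul (hg.smooth 1 0))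
  have hadj : ContDiffOn ℝ ∞ (fun x => (g x).adjugate i j) D := by
    simp only [Matrix.adjugate_fin_two]
    fin_cases i <;> fin_cases j
    · simpa using hg.smooth 1 1
    · simpa using (hg.smooth 0 1).neg
    · simpa using (hg.smooth 1 0).neg
    · simpa using hg.smooth 0 0
  simpa [Matrix.inv_def, Ring.inverse_eq_inv'] using hdet.mul hadj

theorem IsRiemannianMetricOn.contDiffOn_christoffel (hg : IsRiemannianMetricOn g D)
    (hD : IsOpen D) (k i j : Fin 2) : ContDiffOn ℝ ∞ (fun x => christoffel g x k i j) D := by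
  refine contDiffOn_const.mul (ContDiffOn.sum fun l _ => (hg.contDiffOn_inv k l).mul ?_)
  exact ((contDiffOn_partialDeriv hD (hg.smooth j l) i).add
    (contDiffOn_partialDeriv hD (hg.smooth i l) j)).sub
    (contDiffOn_partialDeriv hD (hg.smooth i j) l)

theorem contDiff_snd_apply (i : Fin 2) : ContDiff ℝ ∞ fun z : Plane × Plane => z.2 i :=
  (contDiff_apply ℝ ℝ i).comp contDiff_snd

theorem ContDiffOn.comp_fst_plane {f : Plane → ℝ} (hf : ContDiffOn ℝ ∞ f D) :
    ContDiffOn ℝ ∞ (fun z : Plane × Plane => f z.1) (D ×ˢ univ) :=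
  hf.comp contDiff_fst.contDiffOn fun _ hz => hz.1

theorem IsRiemannianMetricOn.contDiffOn_geodesicSpray (hg : IsRiemannianMetricOn g D)
    (hD : IsOpen D) : ContDiffOn ℝ ∞ (geodesicSpray g) (D ×ˢ univ) := by
  refine contDiffOn_pi.2 fun k => (ContDiffOn.sum fun i _ => ContDiffOn.sum fun j _ => ?_).neg
  exact ((ContDiffOn.comp_fst_plane (hg.contDiffOn_christoffel hD k i j)).mul
    (contDiff_snd_apply i).contDiffOn).mul (contDiff_snd_apply j).contDiffOn

theorem IsRiemannianMetricOn.contDiffOn_speedSq (hg : IsRiemannianMetricOn g D) :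
    ContDiffOn ℝ ∞ (speedSq g) (D ×ˢ univ) := by
  have h : speedSq g = fun z => z.2 0 * (g z.1 0 0 * z.2 0 + g z.1 0 1 * z.2 1)
      + z.2 1 * (g z.1 1 0 * z.2 0 + g z.1 1 1 * z.2 1) :=
    funext fun z => metricInner_eq g z.1 z.2 z.2
  have hs : ∀ i j, ContDiffOn ℝ ∞ (fun z : Plane × Plane => g z.1 i j * z.2 j) (D ×ˢ univ) :=
    fun i j => (ContDiffOn.comp_fst_plane (hg.smooth i j)).mul (contDiff_snd_apply j).contDiffOn
  rw [h]
  exact ((contDiff_snd_apply 0).contDiffOn.mul ((hs 0 0).add (hs 0 1))).add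
    ((contDiff_snd_apply 1).contDiffOn.mul ((hs 1 0).add (hs 1 1)))

theorem geodesicSpray_smul (g : Plane → Matrix (Fin 2) (Fin 2) ℝ) (x v : Plane) (c : ℝ) :
    geodesicSpray g (x, c • v) = c ^ 2 • geodesicSpray g (x, v) := by
  ext k
  simp only [geodesicSpray, Fin.sum_univ_two, Pi.smul_apply, smul_eq_mul]
  ring

theorem geodesicSpray_zero (g : Plane → Matrix (Fin 2) (Fin 2) ℝ) (x : Plane) :
    geodesicSpray g (x, 0) = 0 := by
  simpa using geodesicSpray_smul g x 0 0

theorem speedSq_smul (g : Plane → Matrix (Fin 2) (Fin 2) ℝ) (x v : Plane) (c : ℝ) :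
    speedSq g (x, c • v) = c ^ 2 * speedSq g (x, v) := by
  simp only [speedSq, metricInner_eq, Pi.smul_apply, smul_eq_mul]
  ring

/-- The geodesic equation with the upper index lowered. -/
theorem IsRiemannianMetricOn.lower_geodesicSpray (hg : IsRiemannianMetricOn g D) {x : Plane}
    (hx : x ∈ D) (v : Plane) (l : Fin 2) :
    g x l 0 * geodesicSpray g (x, v) 0 + g x l 1 * geodesicSpray g (x, v) 1
      = -(1 / 2 : ℝ) * ∑ i, ∑ j, (partialDeriv i (fun y => g y j l) x
        + partialDeriv j (fun y => g y i l) x - partialDeriv l (fun y => g y i j) x)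
          * v i * v j := by
  have h : g x * (g x)⁻¹ = 1 := Matrix.mul_nonsing_inv _ (hg.det_pos hx).ne'.isUnit
  have h0 : ∀ m, g x l 0 * (g x)⁻¹ 0 m + g x l 1 * (g x)⁻¹ 1 m = (1 : Matrix _ _ ℝ) l m := by
    intro m
    rw [← h, Matrix.mul_apply, Fin.sum_univ_two]
  have key : ∀ a : Fin 2 → Fin 2 → Fin 2 → ℝ,
      g x l 0 * (-∑ i, ∑ j, (1 / 2 : ℝ) * (∑ m, (g x)⁻¹ 0 m * a i j m) * v i * v j)
        + g x l 1 * (-∑ i, ∑ j, (1 / 2 : ℝ) * (∑ m, (g x)⁻¹ 1 m * a i j m) * v i * v j)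
      = -(1 / 2 : ℝ) * ∑ i, ∑ j, (∑ m, (1 : Matrix _ _ ℝ) l m * a i j m) * v i * v j := by
    intro a
    simp only [← h0, Fin.sum_univ_two]
    ring
  have e := key fun i j m => partialDeriv i (fun y => g y j m) x
        + partialDeriv j (fun y => g y i m) x - partialDeriv m (fun y => g y i j) x
  simp only [Matrix.one_apply, ite_mul, one_mul, zero_mul, Finset.sum_ite_eq, Finset.mem_univ,
    if_true] at e
  exact e

theorem IsRiemannianMetricOn.hasDerivAt_comp (hg : IsRiemannianMetricOn g D) (hD : IsOpen D)
    {γ : ℝ → Plane} {v : Plane} {t : ℝ} (hγ : HasDerivAt γ v t) (ht : γ t ∈ D) (i j : Fin 2) :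
    HasDerivAt (fun s => g (γ s) i j) (v 0 * partialDeriv 0 (fun y => g y i j) (γ t)
      + v 1 * partialDeriv 1 (fun y => g y i j) (γ t)) t := by
  rw [← fderiv_apply_eq_partialDeriv]
  exact ((((hg.smooth i j).differentiableOn (by simp)).differentiableAt
    (hD.mem_nhds ht)).hasFDerivAt).comp_hasDerivAt t hγ

theorem hasDerivAt_comp_of_contDiffOn {f : Plane × Plane → ℝ} (hD : IsOpen D)
    (hf : ContDiffOn ℝ ∞ f (D ×ˢ univ)) {γ v : ℝ → Plane} {γ' v' : Plane} {t : ℝ}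
    (hγ : HasDerivAt γ γ' t) (hv : HasDerivAt v v' t) (ht : γ t ∈ D) :
    HasDerivAt (fun s => f (γ s, v s)) (fderiv ℝ f (γ t, v t) (γ', v')) t :=
  (((hf.differentiableOn (by simp)).differentiableAt
    ((isOpen_prod_univ hD).mem_nhds ⟨ht, trivial⟩)).hasFDerivAt).comp_hasDerivAt t
    (hγ.prodMk hv)

theorem IsRiemannianMetricOn.fderiv_speedSq (hg : IsRiemannianMetricOn g D) (hD : IsOpen D)
    {x : Plane} (hx : x ∈ D) (v a b : Plane) :
    fderiv ℝ (speedSq g) (x, v) (a, b) = 2 * metricInner g x b v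
      + ∑ i, ∑ j, (a 0 * partialDeriv 0 (fun y => g y i j) x
        + a 1 * partialDeriv 1 (fun y => g y i j) x) * v i * v j := by
  have h0 : HasDerivAt (fun s : ℝ => x + s • a) a 0 := by
    simpa using ((hasDerivAt_id (0 : ℝ)).smul_const a).const_add x
  have h1 : HasDerivAt (fun s : ℝ => v + s • b) b 0 := by
    simpa using ((hasDerivAt_id (0 : ℝ)).smul_const b).const_add v
  have h2 := hasDerivAt_comp_of_contDiffOn hD hg.contDiffOn_speedSq h0 h1 (by simpa using hx)
  have hG := fun i j => hg.hasDerivAt_comp hD h0 (by simpa using hx) i j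
  have hV := hasDerivAt_pi.1 h1
  have h3 := ((hV 0).mul (((hG 0 0).mul (hV 0)).add ((hG 0 1).mul (hV 1)))).add
    ((hV 1).mul (((hG 1 0).mul (hV 0)).add ((hG 1 1).mul (hV 1))))
  have h4 := h2.unique (h3.congr_of_eventuallyEq (Filter.Eventually.of_forall fun s => by
    simp [speedSq, metricInner_eq]))
  simp only [zero_smul, add_zero] at h4
  rw [h4, metricInner_eq]
  simp only [Fin.sum_univ_two, hg.symm hx 1 0, Pi.add_apply, Pi.mul_apply, zero_smul, add_zero,
    Pi.zero_apply]
  ring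

/-- The Euler-Lagrange equation of the energy. -/
theorem IsRiemannianMetricOn.hasDerivAt_metricInner (hg : IsRiemannianMetricOn g D)
    (hD : IsOpen D) {γ v δ : ℝ → Plane} {δ' : Plane} {t : ℝ} (hγ : HasDerivAt γ (v t) t)
    (hv : HasDerivAt v (geodesicSpray g (γ t, v t)) t) (hδ : HasDerivAt δ δ' t) (ht : γ t ∈ D) :
    HasDerivAt (fun s => 2 * metricInner g (γ s) (δ s) (v s))
      (fderiv ℝ (speedSq g) (γ t, v t) (δ t, δ')) t := by
  have hG := fun i j => hg.hasDerivAt_comp hD hγ ht i j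
  have hV := hasDerivAt_pi.1 hv
  have hΔ := hasDerivAt_pi.1 hδ
  have h3 := (((hΔ 0).mul (((hG 0 0).mul (hV 0)).add ((hG 0 1).mul (hV 1)))).add
    ((hΔ 1).mul (((hG 1 0).mul (hV 0)).add ((hG 1 1).mul (hV 1))))).const_mul 2
  have l0 := hg.lower_geodesicSpray ht (v t) 0
  have l1 := hg.lower_geodesicSpray ht (v t) 1
  -- Symmetry of the matrix is known only on D, so its derivatives are compared through equality
  -- near the point.
  have hsymm : ∀ k, partialDeriv k (fun y => g y 1 0) (γ t)
      = partialDeriv k (fun y => g y 0 1) (γ t) := fun k => by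
    unfold partialDeriv
    rw [Filter.EventuallyEq.fderiv_eq]
    filter_upwards [hD.mem_nhds ht] with y hy using hg.symm hy 1 0
  refine (h3.congr_of_eventuallyEq (Filter.Eventually.of_forall fun s => by
    simp [metricInner_eq])).congr_deriv ?_
  rw [hg.fderiv_speedSq hD ht, metricInner_eq]
  simp only [Fin.sum_univ_two, hsymm, Pi.add_apply, Pi.mul_apply] at l0 l1 ⊢
  linear_combination 2 * δ t 0 * l0 + 2 * δ t 1 * l1

end Metric

/-! ### Geodesics between nearby points. -/

variable {g : Plane → Matrix (Fin 2) (Fin 2) ℝ} {D : Set Plane}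

/-- The spray is quadratic in the velocity, so on speeds at most r its Lipschitz constant is at most
M·r, which is below 1/8 for small r. The extension to the whole space keeps the constant because
`Plane` carries the sup norm. -/
theorem IsRiemannianMetricOn.exists_lipschitz_extension (hg : IsRiemannianMetricOn g D)
    (hD : IsOpen D) {p₀ : Plane} {R : ℝ} (hR : 0 < R) (hRD : Metric.closedBall p₀ R ⊆ D) :
    ∃ r M : ℝ, ∃ Φ : Plane × Plane → Plane, 0 < r ∧ r ≤ R ∧ r ≤ 1 ∧ 0 ≤ M ∧
      LipschitzWith (1 / 8) Φ ∧
      (∀ x ∈ Metric.closedBall p₀ r, ∀ v : Plane, ‖v‖ ≤ r → geodesicSpray g (x, v) = Φ (x, v)) ∧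
      ∀ x ∈ Metric.closedBall p₀ R, ∀ v, ‖geodesicSpray g (x, v)‖ ≤ M * ‖v‖ ^ 2 := by
  set K := Metric.closedBall p₀ R ×ˢ Metric.closedBall (0 : Plane) 1 with hK
  obtain ⟨M, hM⟩ := exists_lipschitzOnWith_of_contDiffOn (K := K) (isOpen_prod_univ hD)
    ((hg.contDiffOn_geodesicSpray hD).of_le (by simp))
    ((isCompact_closedBall _ _).prod (isCompact_closedBall _ _))
    ((convex_closedBall _ _).prod (convex_closedBall _ _))
    (prod_mono hRD (subset_univ _))
  have hM0 : (0 : ℝ) ≤ M := M.2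
  set r : ℝ := min R (min 1 (1 / (8 * (M + 1)))) with hr
  have hr0 : 0 < r := lt_min hR (lt_min one_pos (by positivity))
  have hrR : r ≤ R := min_le_left _ _
  have hr1 : r ≤ 1 := (min_le_right _ _).trans (min_le_left _ _)
  have hrM : M * r ≤ 1 / 8 := by
    have h : r ≤ 1 / (8 * (M + 1)) := (min_le_right _ _).trans (min_le_right _ _)
    rw [le_div_iff₀ (by positivity)] at h
    nlinarith
  have hscale : ∀ v : Plane, ‖v‖ ≤ r → r⁻¹ • v ∈ Metric.closedBall (0 : Plane) 1 := fun v hv => by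
    rw [mem_closedBall_zero_iff, norm_smul, norm_inv, Real.norm_of_nonneg hr0.le]
    exact inv_mul_le_one_of_le₀ hv hr0.le
  have hL : LipschitzOnWith (1 / 8) (geodesicSpray g)
      (Metric.closedBall p₀ r ×ˢ Metric.closedBall (0 : Plane) r) := by
    refine LipschitzOnWith.of_dist_le_mul ?_
    rintro ⟨x, v⟩ ⟨hx, hv⟩ ⟨x', v'⟩ ⟨hx', hv'⟩
    simp only [mem_closedBall_zero_iff] at hv hv'
    have h1 := hM.dist_le_mul (x, r⁻¹ • v)
      ⟨Metric.closedBall_subset_closedBall hrR hx, hscale v hv⟩ (x', r⁻¹ • v')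
      ⟨Metric.closedBall_subset_closedBall hrR hx', hscale v' hv'⟩
    have h2 : ∀ y w, geodesicSpray g (y, w) = r ^ 2 • geodesicSpray g (y, r⁻¹ • w) := fun y w => by
      rw [← geodesicSpray_smul, smul_inv_smul₀ hr0.ne']
    rw [h2 x v, h2 x' v', dist_smul₀, Real.norm_of_nonneg (by positivity)]
    rw [Prod.dist_eq, dist_smul₀, norm_inv, Real.norm_of_nonneg hr0.le] at h1
    rw [Prod.dist_eq]
    simp only at h1 ⊢
    set m := max (dist x x') (dist v v') with hm
    have hm0 : 0 ≤ m := dist_nonneg.trans (le_max_left _ _)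
    have h3 : max (dist x x') (r⁻¹ * dist v v') ≤ r⁻¹ * m := by
      refine max_le ?_ (mul_le_mul_of_nonneg_left (le_max_right _ _) (by positivity))
      calc dist x x' ≤ m := le_max_left _ _
        _ ≤ r⁻¹ * m := le_mul_of_one_le_left hm0 ((one_le_inv₀ hr0).2 hr1)
    calc r ^ 2 * dist _ _ ≤ r ^ 2 * (M * (r⁻¹ * m)) := by gcongr; exact h1.trans (by gcongr)
      _ = (M * r) * m := by field_simp
      _ ≤ (1 / 8) * m := by gcongr
      _ = _ := by simp
  obtain ⟨Φ, hΦ, hE⟩ := hL.extend_pi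
  refine ⟨r, M, Φ, hr0, hrR, hr1, hM0, hΦ,
    fun x hx v hv => hE ⟨hx, mem_closedBall_zero_iff.2 hv⟩, fun x hx v => ?_⟩
  -- By homogeneity only unit velocities matter; there the Lipschitz bound is used against velocity
  -- 0, where the spray vanishes.
  rcases eq_or_ne v 0 with rfl | hv
  · simp [geodesicSpray_zero]
  · have hv0 : 0 < ‖v‖ := norm_pos_iff.2 hv
    have hu : ‖‖v‖⁻¹ • v‖ = 1 := by
      rw [norm_smul, norm_inv, norm_norm, inv_mul_cancel₀ hv0.ne']
    have h1 := hM.dist_le_mul (x, ‖v‖⁻¹ • v) ⟨hx, by simp [hu]⟩ (x, 0) ⟨hx, by simp⟩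
    rw [geodesicSpray_zero, dist_zero_right, Prod.dist_eq] at h1
    simp only [dist_self, dist_zero_right, hu, zero_le_one, max_eq_right, mul_one] at h1
    have h2 : geodesicSpray g (x, v) = ‖v‖ ^ 2 • geodesicSpray g (x, ‖v‖⁻¹ • v) := by
      rw [← geodesicSpray_smul, smul_inv_smul₀ hv0.ne']
    rw [h2, norm_smul, norm_pow, norm_norm, mul_comm]
    gcongr

/-- `γ p q` is a geodesic from `p` to `q` with velocity `v p q`, for all `p` and `q` near `p₀`;
these geodesics stay in the ball `K` around `p₀`, are nearly straight, and depend on their end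
points in a Lipschitz way. -/
structure IsGeodesicFamily (g : Plane → Matrix (Fin 2) (Fin 2) ℝ) (p₀ : Plane) (r ρ C : ℝ)
    (γ v : Plane → Plane → ℝ → Plane) : Prop where
  source : ∀ p q, γ p q 0 = p
  target : ∀ p q, γ p q 1 = q
  hasDerivAt_curve : ∀ p q t, HasDerivAt (γ p q) (v p q t) t
  mem_closedBall : ∀ p ∈ Metric.ball p₀ ρ, ∀ q ∈ Metric.ball p₀ ρ, ∀ t ∈ Icc (0 : ℝ) 1,
    γ p q t ∈ Metric.closedBall p₀ r
  norm_velocity_le : ∀ p ∈ Metric.ball p₀ ρ, ∀ q ∈ Metric.ball p₀ ρ, ∀ t ∈ Icc (0 : ℝ) 1,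
    ‖v p q t‖ ≤ 1
  hasDerivAt_velocity : ∀ p ∈ Metric.ball p₀ ρ, ∀ q ∈ Metric.ball p₀ ρ, ∀ t ∈ Icc (0 : ℝ) 1,
    HasDerivAt (v p q) (geodesicSpray g (γ p q t, v p q t)) t
  norm_velocity_sub_le : ∀ p ∈ Metric.ball p₀ ρ, ∀ q ∈ Metric.ball p₀ ρ, ∀ t ∈ Icc (0 : ℝ) 1,
    ‖v p q t - (q - p)‖ ≤ C * ‖q - p‖ ^ 2
  lipschitz_curve : ∀ p q p' q', ∀ t ∈ Icc (0 : ℝ) 1,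
    ‖γ p q t - γ p' q' t‖ ≤ 4 * (‖p - p'‖ + ‖q - q'‖)
  lipschitz_velocity : ∀ p q p' q', ∀ t ∈ Icc (0 : ℝ) 1,
    ‖v p q t - v p' q' t‖ ≤ 4 * (‖p - p'‖ + ‖q - q'‖)

theorem IsRiemannianMetricOn.exists_isGeodesicFamily (hg : IsRiemannianMetricOn g D)
    (hD : IsOpen D) {p₀ : Plane} {R : ℝ} (hR : 0 < R) (hRD : Metric.closedBall p₀ R ⊆ D) :
    ∃ r ρ C γ v, r ≤ R ∧ 0 < ρ ∧ ρ ≤ r ∧ IsGeodesicFamily g p₀ r ρ C γ v := by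
  obtain ⟨r, M, Φ, hr0, hrR, hr1, hM0, hΦ, hE, hB⟩ := hg.exists_lipschitz_extension hD hR hRD
  choose z hz using exists_isBVPSolution hΦ
  have hlc : ∀ p q p' q' : Plane, ∀ {y y'}, IsBVPSolution Φ p q y → IsBVPSolution Φ p' q' y' →
      ∀ t ∈ Icc (0 : ℝ) 1, ‖bvpCurve p q y t - bvpCurve p' q' y' t‖
        ≤ 4 * (‖p - p'‖ + ‖q - q'‖) := by
    intro p q p' q' y y' hy hy' t ht
    have h := norm_bvpCurve_le (p - p') (q - q') (z := y - y') ht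
      fun s hs => hy.norm_sub_le hΦ hy' hs
    rw [← bvpCurve_sub p q p' q' hy.continuous hy'.continuous] at h
    have := norm_nonneg (q - q')
    linarith
  have hlv : ∀ p q p' q' : Plane, ∀ {y y'}, IsBVPSolution Φ p q y → IsBVPSolution Φ p' q' y' →
      ∀ t ∈ Icc (0 : ℝ) 1, ‖bvpVelocity p q y t - bvpVelocity p' q' y' t‖
        ≤ 4 * (‖p - p'‖ + ‖q - q'‖) := by
    intro p q p' q' y y' hy hy' t ht
    have h := norm_bvpVelocity_le (p - p') (q - q') (z := y - y') ht
      fun s hs => hy.norm_sub_le hΦ hy' hs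
    rw [← bvpVelocity_sub p q p' q' hy.continuous hy'.continuous] at h
    have := norm_nonneg (q - q')
    have := norm_nonneg (p - p')
    linarith
  -- Comparison with constant curves confines the solutions to the region where Φ is the true spray.
  have hzero : ∀ p ∈ Metric.closedBall p₀ r, IsBVPSolution Φ p p 0 := fun p hp =>
    isBVPSolution_zero (by rw [← hE p hp 0 (by simpa using hr0.le), geodesicSpray_zero])
  have hsmall : ∀ p ∈ Metric.ball p₀ (r / 8), ∀ q ∈ Metric.ball p₀ (r / 8),
      4 * (‖p - p₀‖ + ‖q - p₀‖) ≤ r := by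
    intro p hp q hq
    rw [mem_ball_iff_norm] at hp hq
    linarith
  have hcurve : ∀ p ∈ Metric.ball p₀ (r / 8), ∀ q ∈ Metric.ball p₀ (r / 8), ∀ t ∈ Icc (0 : ℝ) 1,
      bvpCurve p q (z p q) t ∈ Metric.closedBall p₀ r := by
    intro p hp q hq t ht
    have h := hlc p q p₀ p₀ (hz p q) (hzero p₀ (Metric.mem_closedBall_self hr0.le)) t ht
    rw [bvpCurve_self_zero_fun] at h
    rw [mem_closedBall_iff_norm]
    exact h.trans (hsmall p hp q hq)
  have hvel : ∀ p ∈ Metric.ball p₀ (r / 8), ∀ q ∈ Metric.ball p₀ (r / 8), ∀ t ∈ Icc (0 : ℝ) 1,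
      ‖bvpVelocity p q (z p q) t‖ ≤ r := by
    intro p hp q hq t ht
    have h := hlv p q p₀ p₀ (hz p q) (hzero p₀ (Metric.mem_closedBall_self hr0.le)) t ht
    rw [bvpVelocity_zero_fun, sub_self, sub_zero] at h
    exact h.trans (hsmall p hp q hq)
  have hspray : ∀ p ∈ Metric.ball p₀ (r / 8), ∀ q ∈ Metric.ball p₀ (r / 8), ∀ t ∈ Icc (0 : ℝ) 1,
      z p q t = geodesicSpray g (bvpCurve p q (z p q) t, bvpVelocity p q (z p q) t) := by
    intro p hp q hq t ht
    rw [hE _ (hcurve p hp q hq t ht) _ (hvel p hp q hq t ht)]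
    exact (hz p q).eq t ht
  -- The velocity is at most 4‖q - p‖, so the acceleration is at most 16M‖q - p‖²;
  -- `norm_bvpVelocity_sub_le` adds the factor 2.
  refine ⟨r, r / 8, 2 * (M * 16), fun p q => bvpCurve p q (z p q),
    fun p q => bvpVelocity p q (z p q), hrR, by positivity, by linarith, ?_⟩
  exact {
    source := fun p q => bvpCurve_zero p q _
    target := fun p q => bvpCurve_one p q (hz p q).continuous
    hasDerivAt_curve := fun p q t => hasDerivAt_bvpCurve p q (hz p q).continuous t
    mem_closedBall := hcurve
    norm_velocity_le := fun p hp q hq t ht => (hvel p hp q hq t ht).trans hr1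
    hasDerivAt_velocity := fun p hp q hq t ht => by
      rw [← hspray p hp q hq t ht]
      exact hasDerivAt_bvpVelocity p q (hz p q).continuous t
    norm_velocity_sub_le := fun p hp q hq t ht => by
      have h : ∀ s ∈ Icc (0 : ℝ) 1, ‖z p q s‖ ≤ M * 16 * ‖q - p‖ ^ 2 := by
        intro s hs
        have h1 := hlv p q p p (hz p q) (hzero p (Metric.ball_subset_closedBall
          (Metric.ball_subset_ball (by linarith) hp))) s hs
        rw [bvpVelocity_zero_fun, sub_self, sub_zero, norm_zero, zero_add] at h1
        rw [hspray p hp q hq s hs]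
        refine (hB _ (Metric.closedBall_subset_closedBall hrR (hcurve p hp q hq s hs)) _).trans ?_
        calc M * ‖bvpVelocity p q (z p q) s‖ ^ 2 ≤ M * (4 * ‖q - p‖) ^ 2 := by gcongr
          _ = M * 16 * ‖q - p‖ ^ 2 := by ring
      refine (norm_bvpVelocity_sub_le p q ht h).trans (le_of_eq (by ring))
    lipschitz_curve := fun p q p' q' t ht => hlc p q p' q' (hz p q) (hz p' q') t ht
    lipschitz_velocity := fun p q p' q' t ht => hlv p q p' q' (hz p q) (hz p' q') t ht }

/-! ### Regularity, constant speed and length of geodesics. -/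

variable {g : Plane → Matrix (Fin 2) (Fin 2) ℝ} {D : Set Plane}

/-- Bootstrap: if γ and v are of class Cⁿ, so are their derivatives v and the spray along (γ, v). -/
theorem contDiffOn_of_geodesicSpray (hg : IsRiemannianMetricOn g D) (hD : IsOpen D)
    {γ v : ℝ → Plane} (hγ : ∀ t, HasDerivAt γ (v t) t)
    (hv : ∀ t ∈ Icc (0 : ℝ) 1, HasDerivAt v (geodesicSpray g (γ t, v t)) t)
    (hγD : MapsTo γ (Icc 0 1) D) (n : ℕ) :
    ContDiffOn ℝ n γ (Icc 0 1) ∧ ContDiffOn ℝ n v (Icc 0 1) := by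
  have hu : UniqueDiffOn ℝ (Icc (0 : ℝ) 1) := uniqueDiffOn_Icc zero_lt_one
  have hstep : ∀ {f f' : ℝ → Plane}, (∀ t ∈ Icc (0 : ℝ) 1, HasDerivAt f (f' t) t) → ∀ n : ℕ,
      ContDiffOn ℝ n f' (Icc 0 1) → ContDiffOn ℝ (n + 1 : ℕ) f (Icc 0 1) := by
    intro f f' hf n hf'
    have h : ContDiffOn ℝ ((n : WithTop ℕ∞) + 1) f (Icc 0 1) := by
      rw [contDiffOn_succ_iff_derivWithin hu]
      refine ⟨fun t ht => (hf t ht).differentiableAt.differentiableWithinAt, by simp, ?_⟩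
      exact hf'.congr fun t ht => (hf t ht).hasDerivWithinAt.derivWithin (hu t ht)
    exact_mod_cast h
  induction n with
  | zero =>
    rw [Nat.cast_zero, contDiffOn_zero, contDiffOn_zero]
    exact ⟨fun t _ => (hγ t).continuousAt.continuousWithinAt,
      fun t ht => (hv t ht).continuousAt.continuousWithinAt⟩
  | succ n ih =>
    refine ⟨hstep (fun t _ => hγ t) n ih.2, hstep hv n ?_⟩
    exact ((hg.contDiffOn_geodesicSpray hD).of_le (by exact_mod_cast le_top)).comp
      (ih.1.prodMk ih.2) fun t ht => ⟨hγD ht, trivial⟩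

theorem isGeodesicSegment_of_geodesicSpray (hg : IsRiemannianMetricOn g D) (hD : IsOpen D)
    {W : Set Plane} (hW : W ⊆ D) {γ v : ℝ → Plane} (hγ : ∀ t, HasDerivAt γ (v t) t)
    (hv : ∀ t ∈ Icc (0 : ℝ) 1, HasDerivAt v (geodesicSpray g (γ t, v t)) t)
    (hγW : MapsTo γ (Icc 0 1) W) : IsGeodesicSegment g W (γ 0) (γ 1) γ ∧
      ∀ t ∈ Icc (0 : ℝ) 1, velocity γ t = v t := by
  have hu : UniqueDiffOn ℝ (Icc (0 : ℝ) 1) := uniqueDiffOn_Icc zero_lt_one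
  have hvel : ∀ t ∈ Icc (0 : ℝ) 1, velocity γ t = v t := fun t ht =>
    (hγ t).hasDerivWithinAt.derivWithin (hu t ht)
  refine ⟨⟨?_, hγW, rfl, rfl, fun t ht k => ?_⟩, hvel⟩
  · exact contDiffOn_infty.2 fun n =>
      (contDiffOn_of_geodesicSpray hg hD hγ hv (fun t ht => hW (hγW ht)) n).1
  · have hacc : acceleration γ t = geodesicSpray g (γ t, v t) := by
      rw [acceleration, derivWithin_congr hvel (hvel t ht)]
      exact (hv t ht).hasDerivWithinAt.derivWithin (hu t ht)
    rw [hacc, hvel t ht]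
    exact neg_add_cancel _

/-- Geodesics have constant speed. -/
theorem speedSq_eq_of_geodesicSpray (hg : IsRiemannianMetricOn g D) (hD : IsOpen D)
    {γ v : ℝ → Plane} (hγ : ∀ t, HasDerivAt γ (v t) t)
    (hv : ∀ t ∈ Icc (0 : ℝ) 1, HasDerivAt v (geodesicSpray g (γ t, v t)) t)
    (hγD : MapsTo γ (Icc 0 1) D) {t : ℝ} (ht : t ∈ Icc (0 : ℝ) 1) :
    speedSq g (γ t, v t) = speedSq g (γ 0, v 0) := by
  have hd : ∀ s ∈ Icc (0 : ℝ) 1, HasDerivAt (fun s => speedSq g (γ s, v s)) 0 s := by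
    intro s hs
    -- For δ = v the Euler-Lagrange equation equates the derivative of twice the energy with that of
    -- the energy, which therefore vanishes.
    have h1 := hg.hasDerivAt_metricInner hD (hγ s) (hv s hs) (hv s hs) (hγD hs)
    have h2 := hasDerivAt_comp_of_contDiffOn hD hg.contDiffOn_speedSq (hγ s) (hv s hs) (hγD hs)
    have h3 := (h2.const_mul 2).unique h1
    rwa [show fderiv ℝ (speedSq g) (γ s, v s) (v s, geodesicSpray g (γ s, v s)) = 0 by
      linarith] at h2
  exact constant_of_has_deriv_right_zero (f := fun s => speedSq g (γ s, v s))
    (fun s hs => (hd s hs).continuousAt.continuousWithinAt)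
    (fun s hs => (hd s (Ico_subset_Icc_self hs)).hasDerivWithinAt) t ht

theorem length_eq_sqrt_speedSq (hg : IsRiemannianMetricOn g D) (hD : IsOpen D)
    {γ v : ℝ → Plane} (hγ : ∀ t, HasDerivAt γ (v t) t)
    (hv : ∀ t ∈ Icc (0 : ℝ) 1, HasDerivAt v (geodesicSpray g (γ t, v t)) t)
    (hγD : MapsTo γ (Icc 0 1) D) : length g γ = √(speedSq g (γ 0, v 0)) := by
  have hvel := (isGeodesicSegment_of_geodesicSpray hg hD subset_rfl hγ hv hγD).2
  have h : ∀ t ∈ uIcc (0 : ℝ) 1,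
      √(velocity γ t ⬝ᵥ (g (γ t) *ᵥ velocity γ t)) = √(speedSq g (γ 0, v 0)) := by
    intro t ht
    rw [uIcc_of_le zero_le_one] at ht
    rw [hvel t ht, ← speedSq_eq_of_geodesicSpray hg hD hγ hv hγD ht]
    rfl
  rw [length, intervalIntegral.integral_congr h]
  simp

/-! ### First variation of the squared length. -/

namespace IsGeodesicFamily

variable {p₀ : Plane} {r ρ C : ℝ} {γ v : Plane → Plane → ℝ → Plane}

theorem speedSq_eq (hF : IsGeodesicFamily g p₀ r ρ C γ v) (hg : IsRiemannianMetricOn g D)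
    (hD : IsOpen D) (hr : Metric.closedBall p₀ r ⊆ D) {p q : Plane} (hp : p ∈ Metric.ball p₀ ρ)
    (hq : q ∈ Metric.ball p₀ ρ) {t : ℝ} (ht : t ∈ Icc (0 : ℝ) 1) :
    speedSq g (γ p q t, v p q t) = speedSq g (p, v p q 0) := by
  rw [speedSq_eq_of_geodesicSpray hg hD (hF.hasDerivAt_curve p q)
    (hF.hasDerivAt_velocity p hp q hq) (fun s hs => hr (hF.mem_closedBall p hp q hq s hs)) ht,
    hF.source]

theorem speedSq_target_eq (hF : IsGeodesicFamily g p₀ r ρ C γ v) (hg : IsRiemannianMetricOn g D)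
    (hD : IsOpen D) (hr : Metric.closedBall p₀ r ⊆ D) {p q : Plane} (hp : p ∈ Metric.ball p₀ ρ)
    (hq : q ∈ Metric.ball p₀ ρ) : speedSq g (q, v p q 1) = speedSq g (p, v p q 0) := by
  have h := hF.speedSq_eq hg hD hr hp hq (t := 1) (by simp)
  rwa [hF.target] at h

/-- The first variation of the squared distance. -/
theorem exists_firstVariation_bound (hF : IsGeodesicFamily g p₀ r ρ C γ v)
    (hg : IsRiemannianMetricOn g D) (hD : IsOpen D) (hr : Metric.closedBall p₀ r ⊆ D) :
    ∃ M, ∀ p ∈ Metric.ball p₀ ρ, ∀ q ∈ Metric.ball p₀ ρ, ∀ p' ∈ Metric.ball p₀ ρ,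
      ∀ q' ∈ Metric.ball p₀ ρ,
      |speedSq g (p', v p' q' 0) - speedSq g (p, v p q 0)
        - (2 * metricInner g q (q' - q) (v p q 1) - 2 * metricInner g p (p' - p) (v p q 0))|
        ≤ M * (‖p' - p‖ + ‖q' - q‖) ^ 2 := by
  obtain ⟨M, hM0, hM⟩ := exists_taylor_bound
    (K := Metric.closedBall p₀ r ×ˢ Metric.closedBall (0 : Plane) 1) (isOpen_prod_univ hD)
    (hg.contDiffOn_speedSq.of_le (WithTop.coe_le_coe.2 le_top))
    ((isCompact_closedBall _ _).prod (isCompact_closedBall _ _))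
    ((convex_closedBall _ _).prod (convex_closedBall _ _)) (prod_mono hr (subset_univ _))
  refine ⟨M * 16, fun p hp q hq p' hp' q' hq' => ?_⟩
  set N := speedSq g (p, v p q 0)
  set N' := speedSq g (p', v p' q' 0)
  -- By Euler-Lagrange, H' is N' - N minus the differential of the energy in the direction of the
  -- neighbouring geodesic. Both energies are constant in t, so H' is a Taylor remainder, quadratic
  -- by the Lipschitz dependence on the end points. Integrating over [0, 1] leaves the boundary
  -- terms.
  let H : ℝ → ℝ := fun t => t * (N' - N)
    - 2 * metricInner g (γ p q t) (γ p' q' t - γ p q t) (v p q t)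
  have hK : ∀ p ∈ Metric.ball p₀ ρ, ∀ q ∈ Metric.ball p₀ ρ, ∀ t ∈ Icc (0 : ℝ) 1,
      (γ p q t, v p q t) ∈ Metric.closedBall p₀ r ×ˢ Metric.closedBall (0 : Plane) 1 :=
    fun p hp q hq t ht => ⟨hF.mem_closedBall p hp q hq t ht,
      mem_closedBall_zero_iff.2 (hF.norm_velocity_le p hp q hq t ht)⟩
  have hH : ∀ t ∈ Icc (0 : ℝ) 1, HasDerivAt H (N' - N
      - fderiv ℝ (speedSq g) (γ p q t, v p q t)
        ((γ p' q' t, v p' q' t) - (γ p q t, v p q t))) t := by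
    intro t ht
    have h := hg.hasDerivAt_metricInner hD (hF.hasDerivAt_curve p q t)
      (hF.hasDerivAt_velocity p hp q hq t ht)
      ((hF.hasDerivAt_curve p' q' t).sub (hF.hasDerivAt_curve p q t))
      (hr (hF.mem_closedBall p hp q hq t ht))
    refine (((hasDerivAt_id t).mul_const (N' - N)).sub h).congr_deriv ?_
    simp
  have hbound : ∀ t ∈ Ico (0 : ℝ) 1, ‖N' - N - fderiv ℝ (speedSq g) (γ p q t, v p q t)
      ((γ p' q' t, v p' q' t) - (γ p q t, v p q t))‖
        ≤ M * 16 * (‖p' - p‖ + ‖q' - q‖) ^ 2 := by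
    intro t ht
    have ht' := Ico_subset_Icc_self ht
    have h := hM _ (hK p hp q hq t ht') _ (hK p' hp' q' hq' t ht')
    rw [hF.speedSq_eq hg hD hr hp hq ht', hF.speedSq_eq hg hD hr hp' hq' ht'] at h
    refine h.trans ?_
    have h2 : ‖(γ p' q' t, v p' q' t) - (γ p q t, v p q t)‖
        ≤ 4 * (‖p' - p‖ + ‖q' - q‖) :=
      max_le (hF.lipschitz_curve p' q' p q t ht') (hF.lipschitz_velocity p' q' p q t ht')
    calc M * ‖(γ p' q' t, v p' q' t) - (γ p q t, v p q t)‖ ^ 2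
        ≤ M * (4 * (‖p' - p‖ + ‖q' - q‖)) ^ 2 := by gcongr
      _ = _ := by ring
  have h := norm_image_sub_le_of_norm_deriv_le_segment' (f := H) (a := 0) (b := 1)
    (fun t ht => (hH t ht).hasDerivWithinAt) hbound 1 (by simp)
  simp only [H, hF.source, hF.target] at h
  rw [Real.norm_eq_abs] at h
  rw [sub_zero, mul_one] at h
  refine le_of_eq_of_le (congrArg _ ?_) h
  ring

theorem hasDerivAt_speedSq (hF : IsGeodesicFamily g p₀ r ρ C γ v)
    (hg : IsRiemannianMetricOn g D) (hD : IsOpen D) (hr : Metric.closedBall p₀ r ⊆ D)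
    {p q : Plane} (hp : p ∈ Metric.ball p₀ ρ) (hq : q ∈ Metric.ball p₀ ρ) (a b : Plane) :
    HasDerivAt (fun s : ℝ => speedSq g (p + s • a, v (p + s • a) (q + s • b) 0))
      (2 * metricInner g q b (v p q 1) - 2 * metricInner g p a (v p q 0)) 0 := by
  obtain ⟨M, hM⟩ := hF.exists_firstVariation_bound hg hD hr
  have hmem : ∀ x ∈ Metric.ball p₀ ρ, ∀ c : Plane,
      ∀ᶠ s : ℝ in 𝓝 0, x + s • c ∈ Metric.ball p₀ ρ := by
    intro x hx c
    have hc : ContinuousAt (fun s : ℝ => x + s • c) 0 := by fun_prop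
    exact hc.eventually_mem (Metric.isOpen_ball.mem_nhds (by simpa using hx))
  rw [hasDerivAt_iff_isLittleO_nhds_zero]
  refine Asymptotics.IsBigO.trans_isLittleO (g := fun s : ℝ => s ^ 2) ?_ ?_
  · refine Asymptotics.IsBigO.of_bound (M * (‖a‖ + ‖b‖) ^ 2) ?_
    filter_upwards [hmem p hp a, hmem q hq b] with s hs hs'
    have h := hM p hp q hq _ hs _ hs'
    simp only [add_sub_cancel_left, norm_smul] at h
    simp only [zero_add, zero_smul, add_zero, Real.norm_eq_abs, smul_eq_mul] at h ⊢
    have e : ∀ x c w, metricInner g x (s • c) w = s * metricInner g x c w := by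
      intro x c w
      simp only [metricInner_eq, Pi.smul_apply, smul_eq_mul]
      ring
    rw [e, e] at h
    rw [abs_of_nonneg (sq_nonneg s)]
    convert h using 1
    · congr 1
      ring
    · rw [← sq_abs s]
      ring
  · exact (Asymptotics.isLittleO_pow_id one_lt_two)

end IsGeodesicFamily

/-! ### Equal diagonals, momenta and orthogonality. -/

variable {g : Plane → Matrix (Fin 2) (Fin 2) ℝ} {D : Set Plane}

theorem pair_mem_ball {p₀ : Plane} {ρ a b : ℝ} (ha : a ∈ Metric.ball (p₀ 0) ρ)
    (hb : b ∈ Metric.ball (p₀ 1) ρ) : ![a, b] ∈ Metric.ball p₀ ρ := by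
  rw [Metric.mem_ball, dist_pi_lt_iff (dist_nonneg.trans_lt ha)]
  intro i
  fin_cases i
  · simpa using ha
  · simpa using hb

/-- Near `p₀`, the geodesics of the family between opposite corners of a coordinate rectangle
have equal lengths. -/
def HasEqualDiagonals (g : Plane → Matrix (Fin 2) (Fin 2) ℝ) (p₀ : Plane) (ρ : ℝ)
    (v : Plane → Plane → ℝ → Plane) : Prop :=
  ∀ u₁ ∈ Metric.ball (p₀ 0) ρ, ∀ u₂ ∈ Metric.ball (p₀ 0) ρ, ∀ v₁ ∈ Metric.ball (p₀ 1) ρ,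
    ∀ v₂ ∈ Metric.ball (p₀ 1) ρ, u₁ < u₂ → v₁ < v₂ →
      speedSq g (![u₁, v₁], v ![u₁, v₁] ![u₂, v₂] 0)
        = speedSq g (![u₁, v₂], v ![u₁, v₂] ![u₂, v₁] 0)

/-- Lengths are square roots of the constant squared speeds. Balls of the sup norm are coordinate
squares, so they contain the rectangle spanned by their points. -/
theorem HasIvoryProperty.exists_family (hI : HasIvoryProperty g D)
    (hg : IsRiemannianMetricOn g D) (hD : IsOpen D) {p₀ : Plane} (hp₀ : p₀ ∈ D) :
    ∃ r ρ C γ v, 0 < ρ ∧ Metric.ball p₀ ρ ⊆ D ∧ Metric.closedBall p₀ r ⊆ D ∧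
      IsGeodesicFamily g p₀ r ρ C γ v ∧ HasEqualDiagonals g p₀ ρ v := by
  obtain ⟨W, hW, hWD, hIW⟩ := hI p₀ hp₀
  obtain ⟨R, hR, hRW⟩ := Metric.nhds_basis_closedBall.mem_iff.1 hW
  obtain ⟨r, ρ, C, γ, v, hrR, hρ, hρr, hF⟩ := hg.exists_isGeodesicFamily hD hR (hRW.trans hWD)
  have hrW : Metric.closedBall p₀ r ⊆ W := (Metric.closedBall_subset_closedBall hrR).trans hRW
  have hrD := hrW.trans hWD
  have hball : Metric.ball p₀ ρ ⊆ W := (Metric.ball_subset_closedBall.trans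
    (Metric.closedBall_subset_closedBall hρr)).trans hrW
  refine ⟨r, ρ, C, γ, v, hρ, hball.trans hWD, hrD, hF, ?_⟩
  intro u₁ hu₁ u₂ hu₂ v₁ hv₁ v₂ hv₂ hu hv
  have hseg : ∀ p ∈ Metric.ball p₀ ρ, ∀ q ∈ Metric.ball p₀ ρ,
      IsGeodesicSegment g W p q (γ p q) ∧ length g (γ p q) = √(speedSq g (p, v p q 0)) := by
    intro p hp q hq
    have hmaps : MapsTo (γ p q) (Icc 0 1) W := fun t ht => hrW (hF.mem_closedBall p hp q hq t ht)
    have h1 := (isGeodesicSegment_of_geodesicSpray hg hD hWD (hF.hasDerivAt_curve p q)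
      (hF.hasDerivAt_velocity p hp q hq) hmaps).1
    have h2 := length_eq_sqrt_speedSq hg hD (hF.hasDerivAt_curve p q)
      (hF.hasDerivAt_velocity p hp q hq) fun t ht => hWD (hmaps ht)
    rw [hF.source, hF.target] at h1
    rw [hF.source] at h2
    exact ⟨h1, h2⟩
  have hA := pair_mem_ball hu₁ hv₁
  have hC := pair_mem_ball hu₂ hv₂
  have hB := pair_mem_ball hu₂ hv₁
  have hE := pair_mem_ball hu₁ hv₂
  have h := hIW u₁ u₂ v₁ v₂ hu hv (fun u hu v hv => hball (pair_mem_ball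
      ((convex_ball (p₀ 0) ρ).ordConnected.out hu₁ hu₂ hu)
      ((convex_ball (p₀ 1) ρ).ordConnected.out hv₁ hv₂ hv))) _ _
    (hseg _ hA _ hC).1 (hseg _ hE _ hB).1
  rw [(hseg _ hA _ hC).2, (hseg _ hE _ hB).2] at h
  exact (Real.sqrt_inj (hg.speedSq_nonneg (hWD (hball hA)) _)
    (hg.speedSq_nonneg (hWD (hball hE)) _)).1 h

namespace IsGeodesicFamily

variable {p₀ : Plane} {r ρ C : ℝ} {γ v : Plane → Plane → ℝ → Plane}

/-- The first variation compares the momenta of the two diagonals of a coordinate rectangle. -/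
theorem momenta_eq (hF : IsGeodesicFamily g p₀ r ρ C γ v) (hg : IsRiemannianMetricOn g D)
    (hD : IsOpen D) (hr : Metric.closedBall p₀ r ⊆ D) (hd : HasEqualDiagonals g p₀ ρ v)
    {u₁ u₂ v₁ v₂ : ℝ} (hu₁ : u₁ ∈ Metric.ball (p₀ 0) ρ) (hu₂ : u₂ ∈ Metric.ball (p₀ 0) ρ)
    (hv₁ : v₁ ∈ Metric.ball (p₀ 1) ρ) (hv₂ : v₂ ∈ Metric.ball (p₀ 1) ρ) (hu : u₁ < u₂)
    (hv : v₁ < v₂) (a₁ a₂ b₁ b₂ : ℝ) :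
    metricInner g ![u₂, v₂] ![a₂, b₂] (v ![u₁, v₁] ![u₂, v₂] 1)
        - metricInner g ![u₁, v₁] ![a₁, b₁] (v ![u₁, v₁] ![u₂, v₂] 0)
      = metricInner g ![u₂, v₁] ![a₂, b₁] (v ![u₁, v₂] ![u₂, v₁] 1)
        - metricInner g ![u₁, v₂] ![a₁, b₂] (v ![u₁, v₂] ![u₂, v₁] 0) := by
  have h1 := hF.hasDerivAt_speedSq hg hD hr (pair_mem_ball hu₁ hv₁) (pair_mem_ball hu₂ hv₂)
    ![a₁, b₁] ![a₂, b₂]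
  have h2 := hF.hasDerivAt_speedSq hg hD hr (pair_mem_ball hu₁ hv₂) (pair_mem_ball hu₂ hv₁)
    ![a₁, b₂] ![a₂, b₁]
  have hmem : ∀ c x : ℝ, ∀ S : Set ℝ, IsOpen S → x ∈ S → ∀ᶠ s : ℝ in 𝓝 0, x + s * c ∈ S := by
    intro c x S hS hx
    have hc : ContinuousAt (fun s : ℝ => x + s * c) 0 := by fun_prop
    exact hc.eventually_mem (hS.mem_nhds (by simpa using hx))
  have hlt : ∀ c x c' x' : ℝ, x < x' → ∀ᶠ s : ℝ in 𝓝 0, x + s * c < x' + s * c' := by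
    intro c x c' x' hx
    have hc : ContinuousAt (fun s : ℝ => x + s * c) 0 := by fun_prop
    have hc' : ContinuousAt (fun s : ℝ => x' + s * c') 0 := by fun_prop
    exact hc.eventually_lt hc' (by simpa using hx)
  have h3 := h1.unique (h2.congr_of_eventuallyEq ?_)
  · linarith
  -- The perturbed corners still span a rectangle in the ball, so the two squared lengths agree for
  -- all small s and have the same derivative at 0.
  filter_upwards [hmem a₁ u₁ _ Metric.isOpen_ball hu₁, hmem a₂ u₂ _ Metric.isOpen_ball hu₂,
    hmem b₁ v₁ _ Metric.isOpen_ball hv₁, hmem b₂ v₂ _ Metric.isOpen_ball hv₂,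
    hlt a₁ u₁ a₂ u₂ hu, hlt b₁ v₁ b₂ v₂ hv] with s m1 m2 m3 m4 l1 l2
  simpa using hd _ m1 _ m2 _ m3 _ m4 l1 l2

/-- The deviation from the chord is quadratic in its length, so it disappears after rescaling by
τ⁻¹. -/
theorem tendsto_velocity (hF : IsGeodesicFamily g p₀ r ρ C γ v) (hρ : 0 < ρ) {a : ℝ → Plane}
    (ha : Filter.Tendsto a (𝓝[>] 0) (𝓝 p₀)) (w : Plane) {t : ℝ} (ht : t ∈ Icc (0 : ℝ) 1) :
    Filter.Tendsto (fun τ => τ⁻¹ • v (a τ) (a τ + τ • w) t) (𝓝[>] 0) (𝓝 w) := by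
  have hτ : Filter.Tendsto (fun τ : ℝ => τ) (𝓝[>] 0) (𝓝 0) := tendsto_nhdsWithin_of_tendsto_nhds
    Filter.tendsto_id
  have hb : Filter.Tendsto (fun τ => a τ + τ • w) (𝓝[>] 0) (𝓝 p₀) := by
    simpa using ha.add (hτ.smul_const w)
  rw [tendsto_iff_norm_sub_tendsto_zero]
  have hlim : Filter.Tendsto (fun τ : ℝ => C * ‖w‖ ^ 2 * τ) (𝓝[>] 0) (𝓝 0) := by
    simpa using hτ.const_mul (C * ‖w‖ ^ 2)
  refine squeeze_zero' (Filter.Eventually.of_forall fun _ => norm_nonneg _) ?_ hlim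
  filter_upwards [ha.eventually_mem (Metric.ball_mem_nhds p₀ hρ),
    hb.eventually_mem (Metric.ball_mem_nhds p₀ hρ), self_mem_nhdsWithin] with τ h1 h2 h3
  have hτ0 : (0 : ℝ) < τ := h3
  have h := hF.norm_velocity_sub_le _ h1 _ h2 t ht
  rw [add_sub_cancel_left, norm_smul, Real.norm_of_nonneg hτ0.le] at h
  have e : τ⁻¹ • v (a τ) (a τ + τ • w) t - w = τ⁻¹ • (v (a τ) (a τ + τ • w) t - τ • w) := by
    rw [smul_sub, inv_smul_smul₀ hτ0.ne']
  rw [e, norm_smul, norm_inv, Real.norm_of_nonneg hτ0.le, inv_mul_le_iff₀ hτ0]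
  refine h.trans (le_of_eq ?_)
  ring

theorem tendsto_speedSq (hF : IsGeodesicFamily g p₀ r ρ C γ v) (hg : IsRiemannianMetricOn g D)
    (hD : IsOpen D) (hp₀ : p₀ ∈ D) (hρ : 0 < ρ) {a : ℝ → Plane}
    (ha : Filter.Tendsto a (𝓝[>] 0) (𝓝 p₀)) (w : Plane) :
    Filter.Tendsto (fun τ => speedSq g (a τ, v (a τ) (a τ + τ • w) 0) / τ ^ 2) (𝓝[>] 0)
      (𝓝 (speedSq g (p₀, w))) := by
  have hc : ContinuousAt (speedSq g) (p₀, w) :=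
    hg.contDiffOn_speedSq.continuousOn.continuousAt
      ((isOpen_prod_univ hD).mem_nhds ⟨hp₀, trivial⟩)
  have h := hc.tendsto.comp (ha.prodMk_nhds (hF.tendsto_velocity hρ ha w (t := 0) (by simp)))
  refine h.congr fun τ => ?_
  rw [Function.comp_apply, speedSq_smul, inv_pow]
  ring

end IsGeodesicFamily

theorem tendsto_pair_add_mul (p₀ : Plane) (s t : ℝ) :
    Filter.Tendsto (fun τ : ℝ => ![p₀ 0 + τ * s, p₀ 1 + τ * t]) (𝓝[>] 0) (𝓝 p₀) := by
  have hc : Continuous (fun τ : ℝ => ![p₀ 0 + τ * s, p₀ 1 + τ * t]) := by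
    refine continuous_pi fun i => ?_
    fin_cases i <;> simp <;> fun_prop
  refine tendsto_nhdsWithin_of_tendsto_nhds ?_
  convert hc.tendsto 0 using 2
  ext i
  fin_cases i <;> simp

theorem eventually_add_mul_mem_ball (x s : ℝ) {ρ : ℝ} (hρ : 0 < ρ) :
    ∀ᶠ τ : ℝ in 𝓝[>] 0, x + τ * s ∈ Metric.ball x ρ := by
  have hc : Continuous (fun τ : ℝ => x + τ * s) := by fun_prop
  exact (hc.continuousAt.eventually_mem (Metric.isOpen_ball.mem_nhds
    (by simpa using hρ))).filter_mono nhdsWithin_le_nhds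

/-- The coordinate lines are orthogonal. -/
theorem HasIvoryProperty.orthogonal (hI : HasIvoryProperty g D)
    (hg : IsRiemannianMetricOn g D) (hD : IsOpen D) {p₀ : Plane} (hp₀ : p₀ ∈ D) :
    g p₀ 0 1 = 0 := by
  obtain ⟨r, ρ, C, γ, v, hρ, -, hr, hF, hd⟩ := hI.exists_family hg hD hp₀
  have h1 := hF.tendsto_speedSq hg hD hp₀ hρ (a := fun _ => p₀) tendsto_const_nhds ![1, 1]
  have h2 := hF.tendsto_speedSq hg hD hp₀ hρ (tendsto_pair_add_mul p₀ 0 1) ![1, -1]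
  have h3 := tendsto_nhds_unique (h1.congr' ?_) h2
  · simp only [speedSq, metricInner_eq, Matrix.cons_val_zero, Matrix.cons_val_one,
      hg.symm hp₀ 1 0] at h3
    linarith
  filter_upwards [self_mem_nhdsWithin, eventually_add_mul_mem_ball (p₀ 0) 1 hρ,
    eventually_add_mul_mem_ball (p₀ 1) 1 hρ] with τ hτ hu hv
  have hτ0 : (0 : ℝ) < τ := hτ
  have h := hd (p₀ 0) (Metric.mem_ball_self hρ) _ hu (p₀ 1) (Metric.mem_ball_self hρ) _ hv
    (by linarith) (by linarith)
  have e1 : p₀ = ![p₀ 0, p₀ 1] := by ext i; fin_cases i <;> rfl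
  have e2 : p₀ + τ • ![1, 1] = ![p₀ 0 + τ * 1, p₀ 1 + τ * 1] := by
    ext i; fin_cases i <;> simp
  have e3 : ![p₀ 0 + τ * 0, p₀ 1 + τ * 1] = ![p₀ 0, p₀ 1 + τ * 1] := by simp
  have e4 : ![p₀ 0 + τ * 0, p₀ 1 + τ * 1] + τ • ![1, -1] = ![p₀ 0 + τ * 1, p₀ 1] := by
    ext i; fin_cases i <;> simp
  rw [← e1] at h
  rw [e4, e2, e3, h]

/-- The squares `X`, `Y` of the components of the momenta of the diagonals at the corners of a
coordinate rectangle, when the coordinate lines are orthogonal. -/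
theorem IsGeodesicFamily.exists_momenta {p₀ : Plane} {r ρ C : ℝ}
    {γ v : Plane → Plane → ℝ → Plane} (hF : IsGeodesicFamily g p₀ r ρ C γ v)
    (hg : IsRiemannianMetricOn g D) (hD : IsOpen D) (hr : Metric.closedBall p₀ r ⊆ D)
    (hd : HasEqualDiagonals g p₀ ρ v) (hρr : Metric.ball p₀ ρ ⊆ D)
    (h01 : ∀ x ∈ D, g x 0 1 = 0)
    {u₁ u₂ v₁ v₂ : ℝ} (hu₁ : u₁ ∈ Metric.ball (p₀ 0) ρ) (hu₂ : u₂ ∈ Metric.ball (p₀ 0) ρ)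
    (hv₁ : v₁ ∈ Metric.ball (p₀ 1) ρ) (hv₂ : v₂ ∈ Metric.ball (p₀ 1) ρ) (hu : u₁ < u₂)
    (hv : v₁ < v₂) {N X : ℝ} (hN : N = speedSq g (![u₁, v₁], v ![u₁, v₁] ![u₂, v₂] 0))
    (hX : X = (g ![u₁, v₁] 0 0 * v ![u₁, v₁] ![u₂, v₂] 0 0) ^ 2) :
    ∃ X' Y Y' : ℝ, X * (g ![u₁, v₁] 0 0)⁻¹ + Y * (g ![u₁, v₁] 1 1)⁻¹ = N ∧
      X' * (g ![u₂, v₂] 0 0)⁻¹ + Y' * (g ![u₂, v₂] 1 1)⁻¹ = N ∧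
      X' * (g ![u₂, v₁] 0 0)⁻¹ + Y * (g ![u₂, v₁] 1 1)⁻¹ = N ∧
      X * (g ![u₁, v₂] 0 0)⁻¹ + Y' * (g ![u₁, v₂] 1 1)⁻¹ = N := by
  have hA := pair_mem_ball hu₁ hv₁
  have hC := pair_mem_ball hu₂ hv₂
  have hB := pair_mem_ball hu₂ hv₁
  have hE := pair_mem_ball hu₁ hv₂
  have hm := hF.momenta_eq hg hD hr hd hu₁ hu₂ hv₁ hv₂ hu hv
  have hNC := hF.speedSq_target_eq hg hD hr hA hC
  have hNE := hd _ hu₁ _ hu₂ _ hv₁ _ hv₂ hu hv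
  have hNB := hF.speedSq_target_eq hg hD hr hE hB
  have hinner : ∀ x ∈ D, ∀ a b, metricInner g x a b
      = g x 0 0 * (a 0 * b 0) + g x 1 1 * (a 1 * b 1) := by
    intro x hx a b
    rw [metricInner_eq, hg.symm hx 1 0, h01 x hx]
    ring
  have hsq : ∀ x ∈ D, ∀ w : Plane, speedSq g (x, w)
      = (g x 0 0 * w 0) ^ 2 * (g x 0 0)⁻¹ + (g x 1 1 * w 1) ^ 2 * (g x 1 1)⁻¹ := by
    intro x hx w
    have h0 := (hg.diag_pos hx 0).ne'
    have h1 := (hg.diag_pos hx 1).ne'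
    rw [speedSq, hinner x hx]
    field_simp
  rw [← hN] at hNC hNE
  rw [← hNE] at hNB
  rw [hsq _ (hρr hA)] at hN
  rw [hsq _ (hρr hC)] at hNC
  rw [hsq _ (hρr hB)] at hNB
  rw [hsq _ (hρr hE)] at hNE
  simp only [hinner _ (hρr hA), hinner _ (hρr hB), hinner _ (hρr hC), hinner _ (hρr hE),
    Matrix.cons_val_zero, Matrix.cons_val_one] at hm
  -- Moving one side at a time: the u-momenta agree, while the v-momenta are opposite because the
  -- second diagonal descends in v. Squaring removes the sign.
  have m1 := hm 1 0 0 0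
  have m2 := hm 0 1 0 0
  have m3 := hm 0 0 1 0
  have m4 := hm 0 0 0 1
  simp only [one_mul, zero_mul, mul_zero, add_zero, zero_add, sub_zero, zero_sub,
    neg_inj] at m1 m2 m3 m4
  rw [m2] at hNC
  rw [← m3, neg_sq] at hNB
  rw [← m1, ← neg_sq (g ![u₁, v₂] 1 1 * _), ← m4] at hNE
  refine ⟨_, (g ![u₁, v₁] 1 1 * v ![u₁, v₁] ![u₂, v₂] 0 1) ^ 2, _, ?_, hNC, hNB, ?_⟩
  · rw [hX, hN]
  · rw [hX, ← hNE]

/-! ### Mixed second differences and derivatives. -/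

section MixedDifference

variable {D : Set Plane} {φ ψ : Plane → ℝ}

/-- The mixed second difference of `φ` over a coordinate rectangle. -/
def mixedDifference (φ : Plane → ℝ) (u₁ u₂ v₁ v₂ : ℝ) : ℝ :=
  φ ![u₁, v₁] + φ ![u₂, v₂] - φ ![u₂, v₁] - φ ![u₁, v₂]

/-- The mixed second derivative `∂ᵤ∂ᵥφ`. -/
noncomputable def mixedPartial (φ : Plane → ℝ) : Plane → ℝ := partialDeriv 1 (partialDeriv 0 φ)

theorem eq_pair (x : Plane) : x = ![x 0, x 1] := by ext i; fin_cases i <;> rfl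

theorem contDiffOn_mixedPartial (hD : IsOpen D) (hφ : ContDiffOn ℝ ∞ φ D) :
    ContDiffOn ℝ ∞ (mixedPartial φ) D :=
  contDiffOn_partialDeriv hD (contDiffOn_partialDeriv hD hφ 0) 1

theorem differentiableAt_of_contDiffOn (hD : IsOpen D) (hφ : ContDiffOn ℝ ∞ φ D) {x : Plane}
    (hx : x ∈ D) : DifferentiableAt ℝ φ x :=
  (hφ.differentiableOn (by simp)).differentiableAt (hD.mem_nhds hx)

theorem hasDerivAt_pair_left {u v : ℝ} (h : DifferentiableAt ℝ φ ![u, v]) :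
    HasDerivAt (fun s => φ ![s, v]) (partialDeriv 0 φ ![u, v]) u := by
  have h1 : HasDerivAt (fun s : ℝ => (![s, v] : Plane)) (Pi.single 0 1) u := by
    rw [hasDerivAt_pi]
    intro i
    fin_cases i
    · simpa using hasDerivAt_id' u
    · simpa using hasDerivAt_const u v
  exact h.hasFDerivAt.comp_hasDerivAt u h1

theorem hasDerivAt_pair_right {u v : ℝ} (h : DifferentiableAt ℝ φ ![u, v]) :
    HasDerivAt (fun s => φ ![u, s]) (partialDeriv 1 φ ![u, v]) v := by
  have h1 : HasDerivAt (fun s : ℝ => (![u, s] : Plane)) (Pi.single 1 1) v := by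
    rw [hasDerivAt_pi]
    intro i
    fin_cases i
    · simpa using hasDerivAt_const v u
    · simpa using hasDerivAt_id' v
  exact h.hasFDerivAt.comp_hasDerivAt v h1

/-- The mean value theorem in u for the difference of the two horizontal sides, then in v for ∂ᵤφ.
-/
theorem exists_mixedDifference_eq (hD : IsOpen D) (hφ : ContDiffOn ℝ ∞ φ D) {u₁ u₂ v₁ v₂ : ℝ}
    (hu : u₁ < u₂) (hv : v₁ < v₂) (h : ∀ u ∈ Icc u₁ u₂, ∀ v ∈ Icc v₁ v₂, ![u, v] ∈ D) :
    ∃ u ∈ Ioo u₁ u₂, ∃ v ∈ Ioo v₁ v₂,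
      mixedDifference φ u₁ u₂ v₁ v₂ = (u₂ - u₁) * (v₂ - v₁) * mixedPartial φ ![u, v] := by
  have h1 : ∀ u ∈ Icc u₁ u₂, HasDerivAt (fun s => φ ![s, v₂] - φ ![s, v₁])
      (partialDeriv 0 φ ![u, v₂] - partialDeriv 0 φ ![u, v₁]) u := fun u hu' =>
    (hasDerivAt_pair_left (differentiableAt_of_contDiffOn hD hφ (h u hu' v₂ ⟨hv.le, le_rfl⟩))).sub
    (hasDerivAt_pair_left (differentiableAt_of_contDiffOn hD hφ (h u hu' v₁ ⟨le_rfl, hv.le⟩)))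
  obtain ⟨u, hu', e1⟩ := exists_hasDerivAt_eq_slope _ _ hu
    (fun u hu' => (h1 u hu').continuousAt.continuousWithinAt)
    (fun u hu' => h1 u (Ioo_subset_Icc_self hu'))
  have h2 : ∀ v ∈ Icc v₁ v₂, HasDerivAt (fun s => partialDeriv 0 φ ![u, s])
      (mixedPartial φ ![u, v]) v := fun v hv' =>
    hasDerivAt_pair_right (differentiableAt_of_contDiffOn hD (contDiffOn_partialDeriv hD hφ 0)
      (h u (Ioo_subset_Icc_self hu') v hv'))
  obtain ⟨v, hv', e2⟩ := exists_hasDerivAt_eq_slope _ _ hv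
    (fun v hv' => (h2 v hv').continuousAt.continuousWithinAt)
    (fun v hv' => h2 v (Ioo_subset_Icc_self hv'))
  refine ⟨u, hu', v, hv', ?_⟩
  have hu0 : u₂ - u₁ ≠ 0 := (sub_pos.2 hu).ne'
  have hv0 : v₂ - v₁ ≠ 0 := (sub_pos.2 hv).ne'
  rw [e2, mul_assoc, mul_div_cancel₀ _ hv0, e1, mul_div_cancel₀ _ hu0, mixedDifference]
  ring

theorem tendsto_mixedDifference (hD : IsOpen D) (hφ : ContDiffOn ℝ ∞ φ D) {p₀ : Plane}
    (hp₀ : p₀ ∈ D) {s t : ℝ} (hs : 0 < s) (ht : 0 < t) :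
    Filter.Tendsto (fun τ : ℝ =>
      mixedDifference φ (p₀ 0) (p₀ 0 + τ * s) (p₀ 1) (p₀ 1 + τ * t) / τ ^ 2) (𝓝[>] 0)
      (𝓝 (s * t * mixedPartial φ p₀)) := by
  have hc : ContinuousAt (mixedPartial φ) p₀ :=
    (contDiffOn_mixedPartial hD hφ).continuousOn.continuousAt (hD.mem_nhds hp₀)
  rw [Metric.tendsto_nhds]
  intro ε hε
  have hst : 0 < s * t := mul_pos hs ht
  have hε' : 0 < ε / (s * t) := by positivity
  obtain ⟨δ, hδ, hball⟩ := Metric.mem_nhds_iff.1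
    (Filter.inter_mem (hD.mem_nhds hp₀) (hc (Metric.ball_mem_nhds _ hε')))
  filter_upwards [self_mem_nhdsWithin, eventually_add_mul_mem_ball (p₀ 0) s hδ,
    eventually_add_mul_mem_ball (p₀ 1) t hδ] with τ hτ hu hv
  have hτ0 : (0 : ℝ) < τ := hτ
  have hmem : ∀ u ∈ Icc (p₀ 0) (p₀ 0 + τ * s), ∀ v ∈ Icc (p₀ 1) (p₀ 1 + τ * t),
      ![u, v] ∈ Metric.ball p₀ δ := fun u hu' v hv' => pair_mem_ball
    ((convex_ball (p₀ 0) δ).ordConnected.out (Metric.mem_ball_self hδ) hu hu')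
    ((convex_ball (p₀ 1) δ).ordConnected.out (Metric.mem_ball_self hδ) hv hv')
  obtain ⟨u, hu', v, hv', e⟩ := exists_mixedDifference_eq hD hφ
    (lt_add_of_pos_right (p₀ 0) (mul_pos hτ0 hs)) (lt_add_of_pos_right (p₀ 1) (mul_pos hτ0 ht))
    fun u hu' v hv' => (hball (hmem u hu' v hv')).1
  have h := (hball (hmem u (Ioo_subset_Icc_self hu') v (Ioo_subset_Icc_self hv'))).2
  rw [mem_preimage, Metric.mem_ball, Real.dist_eq, lt_div_iff₀ hst] at h
  rw [e, Real.dist_eq, show (p₀ 0 + τ * s - p₀ 0) * (p₀ 1 + τ * t - p₀ 1) * mixedPartial φ ![u, v]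
      / τ ^ 2 - s * t * mixedPartial φ p₀
      = (mixedPartial φ ![u, v] - mixedPartial φ p₀) * (s * t) by field_simp; ring,
    abs_mul, abs_of_pos hst]
  exact h

theorem tendsto_difference_left (hD : IsOpen D) (hφ : ContDiffOn ℝ ∞ φ D) {p₀ : Plane}
    (hp₀ : p₀ ∈ D) (s t : ℝ) :
    Filter.Tendsto (fun τ : ℝ => (φ ![p₀ 0 + τ * s, p₀ 1 + τ * t] - φ p₀) / τ) (𝓝[>] 0)
      (𝓝 (s * partialDeriv 0 φ p₀ + t * partialDeriv 1 φ p₀)) := by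
  have h1 : HasDerivAt (fun τ : ℝ => p₀ + τ • ![s, t]) ![s, t] 0 := by
    simpa using ((hasDerivAt_id (0 : ℝ)).smul_const ![s, t]).const_add p₀
  have h2 : HasFDerivAt φ (fderiv ℝ φ p₀) (p₀ + (0 : ℝ) • ![s, t]) := by
    simpa using (differentiableAt_of_contDiffOn hD hφ hp₀).hasFDerivAt
  have h3 := h2.comp_hasDerivAt 0 h1
  rw [fderiv_apply_eq_partialDeriv, hasDerivAt_iff_tendsto_slope] at h3
  refine (h3.mono_left (nhdsWithin_mono 0 fun x hx => ne_of_gt hx)).congr fun τ => ?_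
  have e : p₀ + τ • ![s, t] = ![p₀ 0 + τ * s, p₀ 1 + τ * t] := by
    ext i; fin_cases i <;> simp
  rw [slope_def_field, Function.comp_apply, Function.comp_apply, e]
  simp

theorem eq_of_hasDerivAt_zero {J : Set ℝ} (hJ : J.OrdConnected) {f : ℝ → ℝ}
    (h : ∀ x ∈ J, HasDerivAt f 0 x) {x y : ℝ} (hx : x ∈ J) (hy : y ∈ J) : f x = f y := by
  have := hJ.convex.norm_image_sub_le_of_norm_hasDerivWithin_le (C := 0) (𝕜 := ℝ)
    (fun x hx => (h x hx).hasDerivWithinAt) (fun x _ => by simp) hy hx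
  rw [zero_mul, norm_le_zero_iff] at this
  linarith

theorem mixedDifference_eq_zero (hD : IsOpen D) (hφ : ContDiffOn ℝ ∞ φ D) {I J : Set ℝ}
    (hI : I.OrdConnected) (hJ : J.OrdConnected) (hIJ : ∀ u ∈ I, ∀ v ∈ J, ![u, v] ∈ D)
    (h : ∀ u ∈ I, ∀ v ∈ J, mixedPartial φ ![u, v] = 0) {u₁ u₂ v₁ v₂ : ℝ} (hu₁ : u₁ ∈ I)
    (hu₂ : u₂ ∈ I) (hv₁ : v₁ ∈ J) (hv₂ : v₂ ∈ J) : mixedDifference φ u₁ u₂ v₁ v₂ = 0 := by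
  have h1 : ∀ u ∈ I, partialDeriv 0 φ ![u, v₁] = partialDeriv 0 φ ![u, v₂] := fun u hu =>
    eq_of_hasDerivAt_zero hJ (f := fun v => partialDeriv 0 φ ![u, v]) (fun v hv => by
      rw [← h u hu v hv]
      exact hasDerivAt_pair_right (differentiableAt_of_contDiffOn hD
        (contDiffOn_partialDeriv hD hφ 0) (hIJ u hu v hv))) hv₁ hv₂
  have h2 := eq_of_hasDerivAt_zero hI (f := fun u => φ ![u, v₁] - φ ![u, v₂]) (fun u hu => by
      have h3 := (hasDerivAt_pair_left (differentiableAt_of_contDiffOn hD hφ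
        (hIJ u hu v₁ hv₁))).sub (hasDerivAt_pair_left (differentiableAt_of_contDiffOn hD hφ
        (hIJ u hu v₂ hv₂)))
      rwa [h1 u hu, sub_self] at h3) hu₁ hu₂
  simp only [mixedDifference] at h2 ⊢
  linarith

theorem partialDeriv_mul {x : Plane} (hφ : DifferentiableAt ℝ φ x) (hψ : DifferentiableAt ℝ ψ x)
    (i : Fin 2) : partialDeriv i (fun y => φ y * ψ y) x
      = φ x * partialDeriv i ψ x + ψ x * partialDeriv i φ x := by
  simp [partialDeriv, fderiv_fun_mul hφ hψ]

theorem partialDeriv_eq_mul_partialDeriv_log {x : Plane} (hφ : DifferentiableAt ℝ φ x)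
    (h0 : 0 < φ x) (i : Fin 2) :
    partialDeriv i φ x = φ x * partialDeriv i (fun y => Real.log (φ y)) x := by
  rw [partialDeriv, partialDeriv, (hφ.hasFDerivAt.log h0.ne').fderiv]
  simp [h0.ne']

theorem mul_mixedPartial_sub (hD : IsOpen D) (hφ : ContDiffOn ℝ ∞ φ D) (h0 : ∀ x ∈ D, 0 < φ x)
    {x : Plane} (hx : x ∈ D) :
    φ x * mixedPartial φ x - partialDeriv 0 φ x * partialDeriv 1 φ x
      = φ x ^ 2 * mixedPartial (fun y => Real.log (φ y)) x := by
  have hlog : ContDiffOn ℝ ∞ (fun y => Real.log (φ y)) D := hφ.log fun x hx => (h0 x hx).ne'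
  have h1 : mixedPartial φ x
      = partialDeriv 1 (fun y => φ y * partialDeriv 0 (fun y => Real.log (φ y)) y) x := by
    rw [mixedPartial, partialDeriv, partialDeriv]
    congr 1
    refine Filter.EventuallyEq.fderiv_eq ?_
    filter_upwards [hD.mem_nhds hx] with y hy
    exact partialDeriv_eq_mul_partialDeriv_log (differentiableAt_of_contDiffOn hD hφ hy) (h0 y hy) 0
  have hd := differentiableAt_of_contDiffOn hD hφ hx
  rw [h1, partialDeriv_mul hd (differentiableAt_of_contDiffOn hD
      (contDiffOn_partialDeriv hD hlog 0) hx), partialDeriv_eq_mul_partialDeriv_log hd (h0 x hx) 0,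
    partialDeriv_eq_mul_partialDeriv_log hd (h0 x hx) 1, mixedPartial]
  ring

end MixedDifference

/-! ### Infinitesimal consequences of the corner equations. -/

variable {g : Plane → Matrix (Fin 2) (Fin 2) ℝ} {D : Set Plane}

theorem HasIvoryProperty.exists_momenta_tendsto (hI : HasIvoryProperty g D)
    (hg : IsRiemannianMetricOn g D) (hD : IsOpen D) {p₀ : Plane} (hp₀ : p₀ ∈ D) {s t : ℝ}
    (hs : 0 < s) (ht : 0 < t) : ∃ N X : ℝ → ℝ,
      Filter.Tendsto (fun τ => N τ / τ ^ 2) (𝓝[>] 0)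
        (𝓝 (g p₀ 0 0 * s ^ 2 + g p₀ 1 1 * t ^ 2)) ∧
      Filter.Tendsto (fun τ => X τ / τ ^ 2) (𝓝[>] 0) (𝓝 ((g p₀ 0 0 * s) ^ 2)) ∧
      ∀ᶠ τ in 𝓝[>] 0, ∃ X' Y Y' : ℝ,
        X τ * (g p₀ 0 0)⁻¹ + Y * (g p₀ 1 1)⁻¹ = N τ ∧
        X' * (g ![p₀ 0 + τ * s, p₀ 1 + τ * t] 0 0)⁻¹
          + Y' * (g ![p₀ 0 + τ * s, p₀ 1 + τ * t] 1 1)⁻¹ = N τ ∧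
        X' * (g ![p₀ 0 + τ * s, p₀ 1] 0 0)⁻¹ + Y * (g ![p₀ 0 + τ * s, p₀ 1] 1 1)⁻¹ = N τ ∧
        X τ * (g ![p₀ 0, p₀ 1 + τ * t] 0 0)⁻¹ + Y' * (g ![p₀ 0, p₀ 1 + τ * t] 1 1)⁻¹ = N τ := by
  have h01 : ∀ x ∈ D, g x 0 1 = 0 := fun x hx => hI.orthogonal hg hD hx
  obtain ⟨r, ρ, C, γ, v, hρ, hρD, hr, hF, hd⟩ := hI.exists_family hg hD hp₀
  refine ⟨fun τ => speedSq g (p₀, v p₀ (p₀ + τ • ![s, t]) 0),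
    fun τ => (g p₀ 0 0 * v p₀ (p₀ + τ • ![s, t]) 0 0) ^ 2, ?_, ?_, ?_⟩
  · convert hF.tendsto_speedSq hg hD hp₀ hρ (a := fun _ => p₀) tendsto_const_nhds ![s, t] using 2
    simp only [speedSq, metricInner_eq, hg.symm hp₀ 1 0, h01 p₀ hp₀, Matrix.cons_val_zero,
      Matrix.cons_val_one]
    ring
  · have h := tendsto_pi_nhds.1 (hF.tendsto_velocity hρ (a := fun _ => p₀) tendsto_const_nhds
      ![s, t] (t := 0) (by simp)) 0
    refine ((h.const_mul (g p₀ 0 0)).pow 2).congr fun τ => ?_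
    simp only [Pi.smul_apply, smul_eq_mul]
    ring
  · filter_upwards [self_mem_nhdsWithin, eventually_add_mul_mem_ball (p₀ 0) s hρ,
      eventually_add_mul_mem_ball (p₀ 1) t hρ] with τ hτ hu hv
    have hτ0 : (0 : ℝ) < τ := hτ
    have h := hF.exists_momenta hg hD hr hd hρD h01 (Metric.mem_ball_self hρ) hu
      (Metric.mem_ball_self hρ) hv (lt_add_of_pos_right _ (mul_pos hτ0 hs))
      (lt_add_of_pos_right _ (mul_pos hτ0 ht)) rfl rfl
    have e : p₀ + τ • ![s, t] = ![p₀ 0 + τ * s, p₀ 1 + τ * t] := by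
      ext i; fin_cases i <;> simp
    rw [← eq_pair p₀] at h
    simpa only [e] using h

/-- The right side is grouped into products of two first differences and one mixed second
difference, so that it is visibly of second order in the size of the rectangle apart from N. -/
theorem momenta_elimination {N X X' Y Y' eA eB eC eD fA fB fC fD : ℝ}
    (hA : X * eA + Y * fA = N) (hC : X' * eC + Y' * fC = N) (hB : X' * eB + Y * fB = N)
    (hE : X * eD + Y' * fD = N) :
    X * (eA * fB * eC * fD - fA * eB * fC * eD)
      = N * ((fB - fA) * ((eC - eB) * fD + eB * (fD - fA)) - fA * eB * (fA + fC - fB - fD)) := by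
  linear_combination (fB * eC * fD) * hA - (fA * eC * fD) * hB + (fA * eB * fD) * hC
    - (fA * eB * fC) * hE

theorem tendsto_differences {φ : Plane → ℝ} (hD : IsOpen D) (hφ : ContDiffOn ℝ ∞ φ D)
    {p₀ : Plane} (hp₀ : p₀ ∈ D) (s t : ℝ) :
    Filter.Tendsto (fun τ : ℝ => (φ ![p₀ 0 + τ * s, p₀ 1] - φ p₀) / τ) (𝓝[>] 0)
        (𝓝 (s * partialDeriv 0 φ p₀)) ∧
      Filter.Tendsto (fun τ : ℝ => (φ ![p₀ 0, p₀ 1 + τ * t] - φ p₀) / τ) (𝓝[>] 0)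
        (𝓝 (t * partialDeriv 1 φ p₀)) ∧
      Filter.Tendsto (fun τ : ℝ => (φ ![p₀ 0 + τ * s, p₀ 1 + τ * t] - φ ![p₀ 0 + τ * s, p₀ 1]) / τ)
        (𝓝[>] 0) (𝓝 (t * partialDeriv 1 φ p₀)) := by
  have h1 := tendsto_difference_left hD hφ hp₀ s 0
  have h2 := tendsto_difference_left hD hφ hp₀ 0 t
  have h3 := (tendsto_difference_left hD hφ hp₀ s t).sub h1
  simp only [mul_zero, add_zero, zero_mul, zero_add, add_sub_cancel_left] at h1 h2 h3
  refine ⟨h1, h2, h3.congr fun τ => ?_⟩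
  ring

theorem tendsto_corners {φ : Plane → ℝ} (hD : IsOpen D) (hφ : ContDiffOn ℝ ∞ φ D)
    {p₀ : Plane} (hp₀ : p₀ ∈ D) (s t : ℝ) :
    Filter.Tendsto (fun τ : ℝ => φ ![p₀ 0 + τ * s, p₀ 1]) (𝓝[>] 0) (𝓝 (φ p₀)) ∧
      Filter.Tendsto (fun τ : ℝ => φ ![p₀ 0, p₀ 1 + τ * t]) (𝓝[>] 0) (𝓝 (φ p₀)) ∧
      Filter.Tendsto (fun τ : ℝ => φ ![p₀ 0 + τ * s, p₀ 1 + τ * t]) (𝓝[>] 0) (𝓝 (φ p₀)) := by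
  have hc : ContinuousAt φ p₀ := hφ.continuousOn.continuousAt (hD.mem_nhds hp₀)
  have h := fun s t => hc.tendsto.comp (tendsto_pair_add_mul p₀ s t)
  refine ⟨?_, ?_, h s t⟩
  · simpa [Function.comp_def] using h s 0
  · simpa [Function.comp_def] using h 0 t

/-- This is the limit of `momenta_elimination` divided by τ⁴: X and N account for τ², the
differences of the coefficients for the other τ². -/
theorem HasIvoryProperty.infinitesimal_relation (hI : HasIvoryProperty g D)
    (hg : IsRiemannianMetricOn g D) (hD : IsOpen D) {p₀ : Plane} (hp₀ : p₀ ∈ D)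
    {e f ρ : Plane → ℝ} (he : e = fun x => (g x 0 0)⁻¹) (hf : f = fun x => (g x 1 1)⁻¹)
    (hρ : ρ = fun x => g x 1 1 * e x) {s t : ℝ} (hs : 0 < s) (ht : 0 < t) :
    (g p₀ 0 0 * s) ^ 2 * (f p₀ ^ 4 * (ρ p₀ * (s * t * mixedPartial ρ p₀)
        - s * partialDeriv 0 ρ p₀ * (t * partialDeriv 1 ρ p₀)))
      = (g p₀ 0 0 * s ^ 2 + g p₀ 1 1 * t ^ 2) * (s * partialDeriv 0 f p₀
          * (t * partialDeriv 1 e p₀ * f p₀ + e p₀ * (t * partialDeriv 1 f p₀))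
        - f p₀ * e p₀ * (s * t * mixedPartial f p₀)) := by
  have hes : ContDiffOn ℝ ∞ e D := by
    rw [he]; exact (hg.smooth 0 0).inv fun x hx => (hg.diag_pos hx 0).ne'
  have hfs : ContDiffOn ℝ ∞ f D := by
    rw [hf]; exact (hg.smooth 1 1).inv fun x hx => (hg.diag_pos hx 1).ne'
  have hρs : ContDiffOn ℝ ∞ ρ D := by
    rw [hρ]; exact (hg.smooth 1 1).mul hes
  have heρ : ∀ x ∈ D, e x = ρ x * f x := fun x hx => by
    have := (hg.diag_pos hx 1).ne'
    simp only [hρ, hf]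
    field_simp
  obtain ⟨N, X, hN, hX, hev⟩ := hI.exists_momenta_tendsto hg hD hp₀ hs ht
  obtain ⟨f1, f2, f3⟩ := tendsto_corners hD hfs hp₀ s t
  obtain ⟨e1, -, -⟩ := tendsto_corners hD hes hp₀ s t
  obtain ⟨df1, df2, -⟩ := tendsto_differences hD hfs hp₀ s t
  obtain ⟨-, -, de3⟩ := tendsto_differences hD hes hp₀ s t
  obtain ⟨dr1, dr2, -⟩ := tendsto_differences hD hρs hp₀ s t
  have mf := tendsto_mixedDifference hD hfs hp₀ hs ht
  have mr := tendsto_mixedDifference hD hρs hp₀ hs ht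
  have hL := hX.mul ((((f1.mul f2).mul f3).const_mul (f p₀)).mul
    ((mr.const_mul (ρ p₀)).sub (dr1.mul dr2)))
  have hR := hN.mul ((df1.mul ((de3.mul f2).add (e1.mul df2))).sub
    ((e1.const_mul (f p₀)).mul mf))
  have hLR := tendsto_nhds_unique (hL.congr' ?_) hR
  · convert hLR using 2
    ring
  have hmem := fun s t => (tendsto_pair_add_mul p₀ s t).eventually_mem (hD.mem_nhds hp₀)
  have m1 := hmem s 0
  have m2 := hmem 0 t
  simp only [mul_zero, add_zero] at m1 m2
  filter_upwards [hev, self_mem_nhdsWithin, hmem s t, m1, m2]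
    with τ ⟨X', Y, Y', hA, hC, hB, hE⟩ hτ mC mB mE
  have hτ0 : τ ≠ 0 := ne_of_gt hτ
  have hef : ∀ x, (g x 0 0)⁻¹ = e x ∧ (g x 1 1)⁻¹ = f x := fun x => by simp [he, hf]
  simp only [(hef _).1, (hef _).2] at hA hB hC hE
  have key := momenta_elimination hA hC hB hE
  -- Substituting e = ρf at the corners factors out the product of the four values of f and leaves
  -- ρ_A ρ_C - ρ_B ρ_E, written as ρ_A times the mixed difference minus a product of first
  -- differences.
  have key' : X τ * (f p₀ * (f ![p₀ 0 + τ * s, p₀ 1] * f ![p₀ 0, p₀ 1 + τ * t]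
      * f ![p₀ 0 + τ * s, p₀ 1 + τ * t])
      * (ρ p₀ * (ρ p₀ + ρ ![p₀ 0 + τ * s, p₀ 1 + τ * t] - ρ ![p₀ 0 + τ * s, p₀ 1]
          - ρ ![p₀ 0, p₀ 1 + τ * t])
        - (ρ ![p₀ 0 + τ * s, p₀ 1] - ρ p₀) * (ρ ![p₀ 0, p₀ 1 + τ * t] - ρ p₀))) = _ :=
    Eq.trans (by rw [heρ _ hp₀, heρ _ mC, heρ _ mE, heρ _ mB]; ring) key
  simp only [mixedDifference]
  rw [← eq_pair p₀]
  linear_combination τ⁻¹ ^ 4 * key'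

theorem HasIvoryProperty.mixedPartial_log_eq_zero (hI : HasIvoryProperty g D)
    (hg : IsRiemannianMetricOn g D) (hD : IsOpen D) {p₀ : Plane} (hp₀ : p₀ ∈ D) :
    mixedPartial (fun x => Real.log (g x 1 1 * (g x 0 0)⁻¹)) p₀ = 0 := by
  have h1 := hI.infinitesimal_relation hg hD hp₀ rfl rfl rfl one_pos one_pos
  have h2 := hI.infinitesimal_relation hg hD hp₀ rfl rfl rfl one_pos two_pos
  have hE := hg.diag_pos hp₀ 0
  have hG := hg.diag_pos hp₀ 1
  have hρ : ContDiffOn ℝ ∞ (fun x => g x 1 1 * (g x 0 0)⁻¹) D :=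
    (hg.smooth 1 1).mul ((hg.smooth 0 0).inv fun x hx => (hg.diag_pos hx 0).ne')
  have h3 := mul_mixedPartial_sub hD hρ
    (fun x hx => mul_pos (hg.diag_pos hx 1) (inv_pos.2 (hg.diag_pos hx 0))) hp₀
  generalize hc : mixedPartial (fun x => Real.log (g x 1 1 * (g x 0 0)⁻¹)) p₀ = c at h3 ⊢
  set f : Plane → ℝ := fun x => (g x 1 1)⁻¹ with hf
  set e : Plane → ℝ := fun x => (g x 0 0)⁻¹ with he
  -- After division by s·t, the ratio t/s enters only through the factor E s² + G t² on the right.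
  -- The choices t = 1 and t = 2 with s = 1 therefore make the other factor vanish.
  have hd : 3 * g p₀ 1 1 * (partialDeriv 0 f p₀
      * (partialDeriv 1 e p₀ * f p₀ + e p₀ * partialDeriv 1 f p₀)
      - f p₀ * e p₀ * mixedPartial f p₀) = 0 := by linear_combination h1 - h2 / 2
  have hd' := (mul_eq_zero.1 hd).resolve_left (by positivity)
  have h4 : (g p₀ 0 0) ^ 2 * (f p₀ ^ 4 * ((g p₀ 1 1 * (g p₀ 0 0)⁻¹) ^ 2 * c)) = 0 := by
    rw [← h3]
    linear_combination h1 + (g p₀ 0 0 + g p₀ 1 1) * hd'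
  have hf0 : f p₀ ≠ 0 := inv_ne_zero hG.ne'
  simpa [hE.ne', hG.ne', hf0] using h4

/-- Multiplied by l, the corner equations have left sides that are sums of a term for the u-side and
a term for the v-side, so their alternating sum is zero: the mixed difference of l times N vanishes.
The limit of N/τ² is E + G > 0. -/
theorem HasIvoryProperty.mixedPartial_conformal_eq_zero (hI : HasIvoryProperty g D)
    (hg : IsRiemannianMetricOn g D) (hD : IsOpen D) {D' : Set Plane} (hD' : IsOpen D')
    (hDD : D' ⊆ D) {l : Plane → ℝ} {U V : ℝ → ℝ} (hl : ContDiffOn ℝ ∞ l D')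
    (hU : ∀ x ∈ D', g x 0 0 = l x * U (x 0)) (hV : ∀ x ∈ D', g x 1 1 = l x * V (x 1))
    {p₀ : Plane} (hp₀ : p₀ ∈ D') : mixedPartial l p₀ = 0 := by
  have hE := hg.diag_pos (hDD hp₀) 0
  have hG := hg.diag_pos (hDD hp₀) 1
  obtain ⟨N, X, hN, -, hev⟩ := hI.exists_momenta_tendsto hg hD (hDD hp₀) one_pos one_pos
  have h1 := (tendsto_mixedDifference hD' hl hp₀ one_pos one_pos).mul hN
  have h2 := tendsto_nhds_unique (h1.congr' (f₂ := fun _ => 0) ?_) tendsto_const_nhds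
  · rcases mul_eq_zero.1 h2 with h | h
    · linarith
    · nlinarith
  have hmem := fun s t => (tendsto_pair_add_mul p₀ s t).eventually_mem (hD'.mem_nhds hp₀)
  have m1 := hmem 1 0
  have m2 := hmem 0 1
  simp only [mul_zero, add_zero] at m1 m2
  filter_upwards [hev, hmem 1 1, m1, m2] with τ ⟨X', Y, Y', hA, hC, hB, hE⟩ mC mB mE
  have hinv : ∀ x ∈ D', ∀ a b : ℝ, a * (g x 0 0)⁻¹ + b * (g x 1 1)⁻¹ = N τ →
      a * (U (x 0))⁻¹ + b * (V (x 1))⁻¹ = N τ * l x := by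
    intro x hx a b h
    have h0 := (hg.diag_pos (hDD hx) 0).ne'
    rw [hU x hx] at h0
    have hl0 := left_ne_zero_of_mul h0
    rw [← h, hU x hx, hV x hx]
    field_simp
  have kA := hinv _ hp₀ _ _ hA
  have kC := hinv _ mC _ _ hC
  have kB := hinv _ mB _ _ hB
  have kE := hinv _ mE _ _ hE
  simp only [Matrix.cons_val_zero, Matrix.cons_val_one] at kA kC kB kE
  have h : mixedDifference l (p₀ 0) (p₀ 0 + τ * 1) (p₀ 1) (p₀ 1 + τ * 1) * N τ = 0 := by
    rw [mixedDifference, ← eq_pair p₀]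
    linear_combination kB + kE - kA - kC
  rw [div_mul_div_comm, h, zero_div]

/-! ### Assembly of the Liouville form. -/

theorem HasIvoryProperty.hasLiouvilleForm (hI : HasIvoryProperty g D)
    (hg : IsRiemannianMetricOn g D) (hD : IsOpen D) {I J : Set ℝ} (hIo : IsOpen I)
    (hIc : I.OrdConnected) (hJo : IsOpen J) (hJc : J.OrdConnected)
    (hIJ : ∀ u ∈ I, ∀ v ∈ J, ![u, v] ∈ D) : HasLiouvilleForm g I J := by
  rcases I.eq_empty_or_nonempty with rfl | ⟨u₀, hu₀⟩
  · exact ⟨0, 0, 0, 0, contDiffOn_const, contDiffOn_const, contDiffOn_const, contDiffOn_const,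
      fun u hu => hu.elim⟩
  rcases J.eq_empty_or_nonempty with rfl | ⟨v₀, hv₀⟩
  · exact ⟨0, 0, 0, 0, contDiffOn_const, contDiffOn_const, contDiffOn_const, contDiffOn_const,
      fun u _ v hv => hv.elim⟩
  have hpos0 : ∀ u ∈ I, ∀ v ∈ J, 0 < g ![u, v] 0 0 := fun u hu v hv => hg.diag_pos (hIJ u hu v hv) 0
  let q : Plane → ℝ := fun x => g x 1 1 * (g x 0 0)⁻¹
  have hqpos : ∀ x ∈ D, 0 < q x := fun x hx =>
    mul_pos (hg.diag_pos hx 1) (inv_pos.2 (hg.diag_pos hx 0))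
  have hq : ContDiffOn ℝ ∞ q D :=
    (hg.smooth 1 1).mul ((hg.smooth 0 0).inv fun x hx => (hg.diag_pos hx 0).ne')
  -- Since log q has zero mixed derivative, q = G/E is a product of a function of u and a function
  -- of v.
  have hsep : ∀ u ∈ I, ∀ v ∈ J, q ![u, v] * q ![u₀, v₀] = q ![u, v₀] * q ![u₀, v] := by
    intro u hu v hv
    have h := mixedDifference_eq_zero hD (hq.log fun x hx => (hqpos x hx).ne') hIc hJc hIJ
      (fun u hu v hv => hI.mixedPartial_log_eq_zero hg hD (hIJ u hu v hv)) hu₀ hu hv₀ hv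
    have p1 := hqpos _ (hIJ u hu v hv)
    have p2 := hqpos _ (hIJ u₀ hu₀ v₀ hv₀)
    have p3 := hqpos _ (hIJ u hu v₀ hv₀)
    have p4 := hqpos _ (hIJ u₀ hu₀ v hv)
    refine Real.log_injOn_pos (mul_pos p1 p2) (mul_pos p3 p4) ?_
    rw [Real.log_mul p1.ne' p2.ne', Real.log_mul p3.ne' p4.ne']
    simp only [mixedDifference] at h
    linarith
  have hleft : ∀ φ : Plane → ℝ, ContDiffOn ℝ ∞ φ D → ContDiffOn ℝ ∞ (fun u => φ ![u, v₀]) I := by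
    intro φ hφ
    refine hφ.comp (ContDiff.contDiffOn ?_) fun u hu => hIJ u hu v₀ hv₀
    refine contDiff_pi.2 fun i => ?_
    fin_cases i
    · exact contDiff_id
    · exact contDiff_const
  have hright : ∀ φ : Plane → ℝ, ContDiffOn ℝ ∞ φ D → ContDiffOn ℝ ∞ (fun v => φ ![u₀, v]) J := by
    intro φ hφ
    refine hφ.comp (ContDiff.contDiffOn ?_) fun v hv => hIJ u₀ hu₀ v hv
    refine contDiff_pi.2 fun i => ?_
    fin_cases i
    · exact contDiff_const
    · exact contDiff_id
  -- The conformal factor l involves q at (u, v₀), which need not lie in D for a general point of D;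
  -- hence the restriction to I × J.
  let D' : Set Plane := {x | x 0 ∈ I ∧ x 1 ∈ J}
  have hD' : IsOpen D' := (hIo.preimage (continuous_apply 0)).inter
    (hJo.preimage (continuous_apply 1))
  have hDD : D' ⊆ D := fun x hx => by rw [eq_pair x]; exact hIJ _ hx.1 _ hx.2
  let l : Plane → ℝ := fun x => g x 0 0 * q ![x 0, v₀]
  have hl : ContDiffOn ℝ ∞ l D' := ((hg.smooth 0 0).mono hDD).mul
    ((hleft q hq).comp (contDiff_apply ℝ ℝ 0).contDiffOn fun x hx => hx.1)
  have hlU : ∀ u ∈ I, ∀ v ∈ J, g ![u, v] 0 0 = l ![u, v] * (q ![u, v₀])⁻¹ := by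
    intro u hu v hv
    have p3 := (hqpos _ (hIJ u hu v₀ hv₀)).ne'
    simp only [l, Matrix.cons_val_zero]
    field_simp
  have hlV : ∀ u ∈ I, ∀ v ∈ J, g ![u, v] 1 1 = l ![u, v] * (q ![u₀, v] * (q ![u₀, v₀])⁻¹) := by
    intro u hu v hv
    have p2 := (hqpos _ (hIJ u₀ hu₀ v₀ hv₀)).ne'
    have pE := (hpos0 u hu v hv).ne'
    have e : g ![u, v] 1 1 = g ![u, v] 0 0 * q ![u, v] := by
      simp only [q]
      field_simp
    have h := hsep u hu v hv
    simp only [l, Matrix.cons_val_zero]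
    rw [e, mul_assoc, ← mul_assoc (q ![u, v₀]), ← h, mul_inv_cancel_right₀ p2]
  have hlmix : ∀ u ∈ I, ∀ v ∈ J, mixedPartial l ![u, v] = 0 := fun u hu v hv =>
    hI.mixedPartial_conformal_eq_zero hg hD hD' hDD hl (U := fun u => (q ![u, v₀])⁻¹)
      (V := fun v => q ![u₀, v] * (q ![u₀, v₀])⁻¹)
      (fun x hx => by rw [eq_pair x]; exact hlU _ hx.1 _ hx.2)
      (fun x hx => by rw [eq_pair x]; exact hlV _ hx.1 _ hx.2) ⟨hu, hv⟩
  have hlleft : ContDiffOn ℝ ∞ (fun u => l ![u, v₀]) I :=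
    (hleft _ (hg.smooth 0 0)).mul (hleft q hq)
  have hlright : ContDiffOn ℝ ∞ (fun v => l ![u₀, v]) J :=
    (hright _ (hg.smooth 0 0)).mul (contDiffOn_const (c := q ![u₀, v₀]))
  -- The vanishing mixed difference based at (u₀, v₀) reads l(u, v) = l(u, v₀) + l(u₀, v) - l(u₀,
  -- v₀), which dictates the choice of U₁ and V₁.
  refine ⟨fun u => l ![u, v₀], fun u => (q ![u, v₀])⁻¹, fun v => l ![u₀, v₀] - l ![u₀, v],
    fun v => q ![u₀, v] * (q ![u₀, v₀])⁻¹, hlleft,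
    (hleft q hq).inv fun u hu => (hqpos _ (hIJ u hu v₀ hv₀)).ne', contDiffOn_const.sub hlright,
    (hright q hq).mul contDiffOn_const, fun u hu v hv => ?_⟩
  have hl' : l ![u, v₀] - (l ![u₀, v₀] - l ![u₀, v]) = l ![u, v] := by
    have h := mixedDifference_eq_zero hD' hl hIc hJc (fun u hu v hv => ⟨hu, hv⟩) hlmix hu₀ hu hv₀ hv
    simp only [mixedDifference] at h
    linarith
  have h01 := hI.orthogonal hg hD (hIJ u hu v hv)
  rw [hl']
  ext i j
  fin_cases i <;> fin_cases j
  · simpa using hlU u hu v hv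
  · simpa using h01
  · simpa [hg.symm (hIJ u hu v hv) 1 0] using h01
  · simpa using hlV u hu v hv

end IvoryLiouville

theorem mainTheorem3 (D : Set IvoryLiouville.Plane) (hD : IsOpen D)
    (g : IvoryLiouville.Plane → Matrix (Fin 2) (Fin 2) ℝ)
    (hg : IvoryLiouville.IsRiemannianMetricOn g D)
    (hI : IvoryLiouville.HasIvoryProperty g D) :
    (∀ x ∈ D, g x 0 1 = 0) ∧
    ∀ I J : Set ℝ, IsOpen I → I.OrdConnected → IsOpen J → J.OrdConnected →
      (∀ u ∈ I, ∀ v ∈ J, ![u, v] ∈ D) →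
      IvoryLiouville.HasLiouvilleForm g I J :=
  ⟨fun _ hx => hI.orthogonal hg hD hx, fun _ _ hIo hIc hJo hJc hIJ =>
    hI.hasLiouvilleForm hg hD hIo hIc hJo hJc hIJ⟩
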